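/- For each $n\ge 1$ let $X=(X_{ij})_{1\le i,j\le n}$ be a complex Ginibre matrix, i.e. its entries are independent standard complex Gaussian variables $X_{ij}\sim\mathcal N_{\mathbb C}(0,1)$ (real and imaginary parts independent, each with law $\mathcal N(0,1/2)$). Let $\mu_n=\frac1n\sum_{j=1}^n\delta_{\lambda_j(X/\sqrt n)}$ be the empirical distribution of the eigenvalues (with algebraic multiplicity) of $X/\sqrt n$, let $\bar\mu_n=\mathbb E\mu_n$, and let $\mu_\infty$ be the uniform distribution on the unit disc, $d\mu_\infty(z)=\frac1\pi\mathbf 1_{B_1(0)}(z)\,dz$, where $B_R(z_0)=\{z\in\mathbb C:|z-z_0|<R\}$. For measures $\mu,\nu$ on $\mathbb C$ put $D(\mu,\nu)=\sup_{z_0\in\mathbb C,\,R>0}|\mu(B_R(z_0))-\nu(B_R(z_0))|$. Then: (i) $D(\bar\mu_n,\mu_\infty)\sim\dfrac1{\sqrt{2\pi n}}$ as $n\to\infty$, i.e. the quotient of the two sides tends to $1$; (ii) for every $n\ge1$ the supremum is attained at the unit ball: $D(\bar\mu_n,\mu_\infty)=|\bar\mu_n(B_1(0))-\mu_\infty(B_1(0))|$;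 (iii) there is an absolute constant $C>0$ such that for all $n\ge1$ and all $\varepsilon>0$ $$\sup\bigl|\bar\mu_n(B_R(z_0))-\mu_\infty(B_R(z_0))\bigr|\le C\,e^{-n\varepsilon^2},$$ where the supremum is over all $z_0\in\mathbb C$, $R>0$ with $B_R(z_0)\subseteq\mathbb C\setminus B_{1+\varepsilon}(0)$ or $B_R(z_0)\subseteq B_{1-\varepsilon}(0)$ (with $B_r(0)=\emptyset$ for $r\le0$). -/

import Mathlib

open MeasureTheory ProbabilityTheory Filter Asymptotics
open scoped ENNReal NNReal

noncomputable section

/-- The standard complex normal law `N_ℂ(0,1)` on `ℂ`: the real and the imaginary part are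
independent real Gaussians with mean `0` and variance `1/2`. -/
def stdComplexGaussian : Measure ℂ :=
  ((gaussianReal 0 (1 / 2)).prod (gaussianReal 0 (1 / 2))).map Complex.measurableEquivRealProd.symm

/-- `X` is a Ginibre matrix of size `n` on the probability space `(Ω, P)`: its `n²` entries are
independent with law `N_ℂ(0,1)`. -/
structure IsGinibre {Ω : Type*} [MeasurableSpace Ω] {n : ℕ}
    (X : Ω → Matrix (Fin n) (Fin n) ℂ) (P : Measure Ω) : Prop where
  hasLaw_entry : ∀ i j, HasLaw (fun ω => X ω i j) stdComplexGaussian P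
  indep : iIndepFun (fun (p : Fin n × Fin n) (ω : Ω) => X ω p.1 p.2) P

/-- The measure `(1/n) ∑ⱼ δ_{λⱼ(A)}`, where the eigenvalues `λⱼ(A)` of the complex `n × n` matrix
`A`, repeated according to algebraic multiplicity, are the roots of its characteristic
polynomial. -/
def spectralMeasure {n : ℕ} (A : Matrix (Fin n) (Fin n) ℂ) : Measure ℂ :=
  (n : ℝ≥0∞)⁻¹ • (A.charpoly.roots.map (fun z => Measure.dirac z)).sum

/-- The empirical spectral distribution `μ_n` of `X`: the eigenvalue distribution of the scaled
matrix `X / √n`. -/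
def empiricalSpectralDistribution {n : ℕ} (A : Matrix (Fin n) (Fin n) ℂ) : Measure ℂ :=
  spectralMeasure (((Real.sqrt n : ℝ) : ℂ)⁻¹ • A)

/-- The mean empirical spectral distribution `μ̄_n = 𝔼 μ_n`, that is, the measure
`B ↦ ∫ μ_n(B) dP` on `ℂ`. -/
def meanSpectralDistribution {Ω : Type*} [MeasurableSpace Ω] {n : ℕ}
    (X : Ω → Matrix (Fin n) (Fin n) ℂ) (P : Measure Ω) : Measure ℂ :=
  P.bind (fun ω => empiricalSpectralDistribution (X ω))

/-- The circular law `μ_∞`: the uniform distribution on the unit disc, with density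
`(1/π) 1_{B_1(0)}` with respect to Lebesgue measure on `ℂ`. -/
def circularLaw : Measure ℂ :=
  volume.withDensity ((Metric.ball (0 : ℂ) 1).indicator (fun _ => ENNReal.ofReal (1 / Real.pi)))

/-- `sup_{B ∈ 𝓢} |μ(B) - ν(B)|` over a family `𝓢` of sets. -/
def supDiff (𝓢 : Set (Set ℂ)) (μ ν : Measure ℂ) : ℝ :=
  sSup ((fun B => |μ.real B - ν.real B|) '' 𝓢)

/-- For finite measures the supremum in `supDiff` is over a bounded set of reals. -/
theorem bddAbove_supDiff (𝓢 : Set (Set ℂ)) (μ ν : Measure ℂ) [IsFiniteMeasure μ]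
    [IsFiniteMeasure ν] : BddAbove ((fun B => |μ.real B - ν.real B|) '' 𝓢) := by
  refine ⟨μ.real Set.univ + ν.real Set.univ, ?_⟩
  rintro _ ⟨B, -, rfl⟩
  have h1 : μ.real B ≤ μ.real Set.univ := measureReal_mono (Set.subset_univ B)
  have h2 : ν.real B ≤ ν.real Set.univ := measureReal_mono (Set.subset_univ B)
  have h3 : 0 ≤ μ.real B := measureReal_nonneg
  have h4 : 0 ≤ ν.real B := measureReal_nonneg
  exact abs_le.2 ⟨by linarith, by linarith⟩

/-- All balls `B_R(z₀)` with `z₀ ∈ ℂ` and `R > 0`. -/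
def allBalls : Set (Set ℂ) :=
  {B | ∃ (z₀ : ℂ) (R : ℝ), 0 < R ∧ B = Metric.ball z₀ R}

/-- The balls `B_R(z₀)`, `R > 0`, with `B_R(z₀) ⊆ ℂ \ B_{1+ε}(0)` or `B_R(z₀) ⊆ B_{1-ε}(0)`. -/
def ballsAwayFromEdge (ε : ℝ) : Set (Set ℂ) :=
  {B | B ∈ allBalls ∧ (B ⊆ (Metric.ball 0 (1 + ε))ᶜ ∨ B ⊆ Metric.ball 0 (1 - ε))}

/-- The discrepancy `D(μ, ν) = sup_{z₀ ∈ ℂ, R > 0} |μ(B_R(z₀)) - ν(B_R(z₀))|`. -/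
def discrepancy (μ ν : Measure ℂ) : ℝ :=
  supDiff allBalls μ ν

end

/-! The heart of the matter is that $\bar\mu_n$ has the explicit density
$\pi^{-1}\Pr(\mathrm{Poisson}(n|z|^2)<n)$, named `circularDensity`. Everything else follows from it.

The density is found by conditioning on one left eigenvector. Write the unscaled matrix of size
$m+1$ as upper rows $W=(A\mid c)$ and a last row $(r,x)$. A left eigenvector $(v,1)$ with eigenvalue
$z$ forces $(r,x)=z(v,1)-vW$, so for fixed $W$ the last row can be traded for $(v,z)$, with Jacobian
$|\det(z-A+cv)|^2$ (`lintegral_gaussian_row_ge`). A unitary conjugation deflates the eigenvector: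
after an affine substitution in $W$ the Gaussian weight is again standard, and the Jacobian becomes
the squared determinant of $z$ minus a Ginibre matrix of size $m$ (`exists_deflation`). Its mean is
$\sum_{k\le m}\frac{m!}{k!}|z|^{2k}$ (`integral_normSq_det_sub`), and the remaining integral over
$v$ equals $\pi^m/m!$.

Only one inequality of the area formula is needed: it shows that the explicit density is dominated
by $\bar\mu_n$. As the density has mass 1 and $\bar\mu_n$ has mass at most 1, the two measures agree
(`IsGinibre.meanSpectralDistribution_eq_withDensity`).

A Poisson probability is at most 1, so $\bar\mu_n\le\mu_\infty$ inside the unit disc, while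
$\mu_\infty$ vanishes outside. Hence no measurable set has a larger discrepancy than the disc itself
(`abs_measureReal_sub_le`). The radial integral is elementary and gives
$1-\bar\mu_n(B_1(0))=e^{-n}n^n/n!$, so (i) is Stirling's formula. For (iii), monotonicity reduces to
the centred balls of radius $1\pm\varepsilon$, where a Chernoff bound gives the estimate with $C=1$.
-/

/-! ### The area formula in the plane, as an inequality. -/

/-- The real determinant of multiplication by a complex number is its squared modulus. -/
theorem det_restrictScalars_toSpanSingleton (c : ℂ) :
    ((ContinuousLinearMap.toSpanSingleton ℂ c).restrictScalars ℝ : ℂ →L[ℝ] ℂ).det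
      = Complex.normSq c := by
  have h : ((ContinuousLinearMap.toSpanSingleton ℂ c : ℂ →L[ℂ] ℂ) : ℂ →ₗ[ℂ] ℂ).det = c := by
    rw [← LinearMap.det_toMatrix (Module.Basis.singleton Unit ℂ)]
    simp [Matrix.det_unique, LinearMap.toMatrix_apply]
  rw [ContinuousLinearMap.det, ← Algebra.norm_complex_apply, ← h, ← LinearMap.det_restrictScalars]
  simp

/-- One half of the area formula in the complex plane: a lower bound for the number of preimages
weighted by `g`. -/
theorem lintegral_comp_mul_normSq_deriv_le {f f' : ℂ → ℂ} {s : Set ℂ} (hs : MeasurableSet s)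
    (hf : ∀ z ∈ s, HasDerivAt f (f' z) z) (hf0 : ∀ z ∈ s, f' z ≠ 0) {g N : ℂ → ℝ≥0∞}
    (hg : Measurable g)
    (hN : ∀ x, ∀ F : Finset ℂ, (∀ z ∈ F, z ∈ s ∧ f z = x) → (F.card : ℝ≥0∞) ≤ N x) :
    ∫⁻ z in s, g (f z) * ENNReal.ofReal (Complex.normSq (f' z)) ≤ ∫⁻ x, g x * N x := by
  classical
  set D : ℂ → ℂ →L[ℝ] ℂ := fun z => (ContinuousLinearMap.toSpanSingleton ℂ (f' z)).restrictScalars ℝ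
  have hD : ∀ z ∈ s, HasFDerivWithinAt f (D z) s z := fun z hz =>
    ((hf z hz).hasFDerivAt.restrictScalars ℝ).hasFDerivWithinAt
  obtain ⟨t, A, tdisj, tmeas, tcov, tapp, tA⟩ :=
    exists_partition_approximatesLinearOn_of_hasFDerivWithinAt f s D hD
      -- An error below half of $|f'(w)|$ makes $f$ injective on each piece. The value 1 only serves
      -- to keep the tolerance nonzero: the maps that occur are derivatives at points of `s`, where
      -- $f'\ne0$.
      (fun A => if ‖A 1‖₊ = 0 then 1 else ‖A 1‖₊ / 2) (fun A => by
        split_ifs with h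
        · exact one_ne_zero
        · positivity)
  have hinj : ∀ k, Set.InjOn f (s ∩ t k) := by
    intro k x hx y hy hxy
    obtain ⟨w, hw, hAw⟩ := tA ⟨x, hx.1⟩ k
    have h1 := tapp k x hx y hy
    have hA1 : A k 1 = f' w := by simp [hAw, D]
    have hAxy : A k (x - y) = (x - y) * f' w := by simp [hAw, D]
    have hne : ‖f' w‖ ≠ 0 := norm_ne_zero_iff.2 (hf0 w hw)
    have hne' : ‖f' w‖₊ ≠ 0 := nnnorm_ne_zero_iff.2 (hf0 w hw)
    rw [hA1, hAxy, hxy, if_neg hne'] at h1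
    simp only [sub_self, zero_sub, norm_neg, norm_mul, NNReal.coe_div, coe_nnnorm] at h1
    have : ‖x - y‖ ≤ 0 := by
      by_contra hc
      push Not at hc
      have : 0 < ‖f' w‖ := lt_of_le_of_ne (norm_nonneg _) hne.symm
      norm_num at h1
      nlinarith [mul_pos hc this]
    exact sub_eq_zero.1 (norm_le_zero_iff.1 this)
  have hmeas : ∀ k, MeasurableSet (s ∩ t k) := fun k => hs.inter (tmeas k)
  have hDk : ∀ k, ∀ x ∈ s ∩ t k, HasFDerivWithinAt f (D x) (s ∩ t k) x := fun k x hx =>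
    (hD x hx.1).mono Set.inter_subset_left
  have himg : ∀ k, MeasurableSet (f '' (s ∩ t k)) := fun k =>
    measurable_image_of_fderivWithin (hmeas k) (hDk k) (hinj k)
  have hpiece : ∀ k, ∫⁻ z in s ∩ t k, g (f z) * ENNReal.ofReal (Complex.normSq (f' z))
      = ∫⁻ x, (f '' (s ∩ t k)).indicator g x := by
    intro k
    rw [lintegral_indicator (himg k),
      lintegral_image_eq_lintegral_abs_det_fderiv_mul volume (hmeas k) (hDk k) (hinj k)]
    refine lintegral_congr fun z => ?_
    rw [show (D z).det = Complex.normSq (f' z) from det_restrictScalars_toSpanSingleton _,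
      abs_of_nonneg (Complex.normSq_nonneg _), mul_comm]
  have hunion : s = ⋃ k, s ∩ t k := by
    rw [← Set.inter_iUnion, Set.inter_eq_left.2 tcov]
  calc ∫⁻ z in s, g (f z) * ENNReal.ofReal (Complex.normSq (f' z))
      = ∑' k, ∫⁻ z in s ∩ t k, g (f z) * ENNReal.ofReal (Complex.normSq (f' z)) := by
        conv_lhs => rw [hunion]
        rw [lintegral_iUnion hmeas]
        exact fun i j hij => (tdisj hij).mono Set.inter_subset_right Set.inter_subset_right
    _ = ∑' k, ∫⁻ x, (f '' (s ∩ t k)).indicator g x := by simp_rw [hpiece]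
    _ = ∫⁻ x, ∑' k, (f '' (s ∩ t k)).indicator g x := by
        rw [lintegral_tsum fun k => (hg.indicator (himg k)).aemeasurable]
    _ ≤ ∫⁻ x, g x * N x := by
        refine lintegral_mono fun x => ?_
        rw [ENNReal.tsum_eq_iSup_sum]
        refine iSup_le fun I => ?_
        -- The pieces are disjoint, so picking one preimage of `x` in each piece of `J` gives
        -- `J.card` distinct preimages.
        set J := I.filter fun k => x ∈ f '' (s ∩ t k)
        have hJ : ∀ k ∈ J, ∃ z, z ∈ s ∩ t k ∧ f z = x := fun k hk => (Finset.mem_filter.1 hk).2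
        choose! ζ hζ using hJ
        have hcard : (J.image ζ).card = J.card := by
          refine Finset.card_image_of_injOn fun i hi j hj hij => ?_
          by_contra hne
          exact Set.disjoint_left.1 (tdisj hne) (hζ i hi).1.2 (hij ▸ (hζ j hj).1.2)
        have := hN x (J.image ζ) (by
          intro z hz
          obtain ⟨k, hk, rfl⟩ := Finset.mem_image.1 hz
          exact ⟨(hζ k hk).1.1, (hζ k hk).2⟩)
        rw [hcard] at this
        calc ∑ k ∈ I, (f '' (s ∩ t k)).indicator g x = ∑ k ∈ J, g x := by
              rw [Finset.sum_filter]
              exact Finset.sum_congr rfl fun k _ => by simp [Set.indicator_apply]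
          _ = g x * J.card := by rw [Finset.sum_const, nsmul_eq_mul, mul_comm]
          _ ≤ g x * N x := by gcongr

/-! ### Product integrals and product densities. -/

theorem lintegral_fin_prod_eq_prod {n : ℕ} {E : Fin n → Type*} (f : (i : Fin n) → E i → ℝ≥0∞)
    {mE : ∀ i, MeasurableSpace (E i)} {μ : (i : Fin n) → Measure (E i)} [∀ i, SigmaFinite (μ i)]
    (hf : ∀ i, Measurable (f i)) :
    ∫⁻ x, ∏ i, f i (x i) ∂(Measure.pi μ) = ∏ i, ∫⁻ x, f i x ∂(μ i) := by
  induction n with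
  | zero => simp
  | succ n ih =>
    calc ∫⁻ x, ∏ i, f i (x i) ∂(Measure.pi μ)
        = ∫⁻ x : E 0 × ((i : Fin n) → E (Fin.succ i)),
            f 0 x.1 * ∏ i : Fin n, f (Fin.succ i) (x.2 i)
              ∂((μ 0).prod (Measure.pi (fun i => μ i.succ))) := by
          refine (((measurePreserving_piFinSuccAbove μ 0).symm).lintegral_comp_emb
            (MeasurableEquiv.measurableEmbedding _) _).symm.trans (lintegral_congr fun x => ?_)
          rw [Fin.prod_univ_succ]
          rfl
      _ = (∫⁻ x, f 0 x ∂μ 0) * ∏ i : Fin n, ∫⁻ x, f (Fin.succ i) x ∂(μ i.succ) := by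
          rw [lintegral_prod_mul (f := f 0)
            (g := fun y : ((i : Fin n) → E (Fin.succ i)) => ∏ i, f (Fin.succ i) (y i))
            (hf 0).aemeasurable, ih]
          · exact fun i => hf _
          · exact (Finset.measurable_prod _
              fun i _ => (hf _).comp (measurable_pi_apply i)).aemeasurable
      _ = ∏ i, ∫⁻ x, f i x ∂(μ i) := by rw [Fin.prod_univ_succ]

/-- Tonelli's theorem for a product of functions of the separate variables. -/
theorem lintegral_fintype_prod_eq_prod {ι : Type*} [Fintype ι] {E : ι → Type*}
    (f : (i : ι) → E i → ℝ≥0∞)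
    {mE : ∀ i, MeasurableSpace (E i)} {μ : (i : ι) → Measure (E i)} [∀ i, SigmaFinite (μ i)]
    (hf : ∀ i, Measurable (f i)) :
    ∫⁻ x : (i : ι) → E i, ∏ i, f i (x i) ∂(Measure.pi μ) = ∏ i, ∫⁻ x, f i x ∂(μ i) := by
  let e := (Fintype.equivFin ι).symm
  rw [← (measurePreserving_piCongrLeft _ e).lintegral_comp_emb
    (MeasurableEquiv.measurableEmbedding _)]
  simp_rw [← e.prod_comp, MeasurableEquiv.coe_piCongrLeft, Equiv.piCongrLeft_apply_apply]
  exact lintegral_fin_prod_eq_prod _ fun i => hf _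

theorem pi_withDensity {ι : Type*} [Fintype ι] {E : ι → Type*}
    {f : (i : ι) → E i → ℝ≥0∞} {mE : ∀ i, MeasurableSpace (E i)} {μ : (i : ι) → Measure (E i)}
    [∀ i, SigmaFinite (μ i)] (hf : ∀ i, Measurable (f i))
    [∀ i, SigmaFinite ((μ i).withDensity (f i))] :
    Measure.pi (fun i => (μ i).withDensity (f i))
      = (Measure.pi μ).withDensity (fun x => ∏ i, f i (x i)) := by
  refine Measure.pi_eq (μ := fun i => (μ i).withDensity (f i)) fun s hs => ?_
  rw [withDensity_apply _ (MeasurableSet.univ_pi hs),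
    ← lintegral_indicator (MeasurableSet.univ_pi hs)]
  have : (fun x : (i : ι) → E i => (Set.univ.pi s).indicator (fun x => ∏ i, f i (x i)) x)
      = fun x => ∏ i, (s i).indicator (f i) (x i) := by
    funext x
    by_cases h : x ∈ Set.univ.pi s
    · rw [Set.indicator_of_mem h]
      exact Finset.prod_congr rfl fun i _ => (Set.indicator_of_mem (h i trivial) _).symm
    · rw [Set.indicator_of_notMem h]
      simp only [Set.mem_pi, Set.mem_univ, forall_const, not_forall] at h
      obtain ⟨i, hi⟩ := h
      exact (Finset.prod_eq_zero (Finset.mem_univ i) (Set.indicator_of_notMem hi _)).symm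
  rw [this, lintegral_fintype_prod_eq_prod _ fun i => (hf i).indicator (hs i)]
  exact Finset.prod_congr rfl fun i _ => by
    rw [withDensity_apply _ (hs i), lintegral_indicator (hs i)]

/-! ### The complex Gaussian law: density, second moments and the permanent that they produce. -/

/-- The density of the standard complex Gaussian law. -/
noncomputable def gaussDensity (z : ℂ) : ℝ≥0∞ :=
  ENNReal.ofReal (Real.pi⁻¹ * Real.exp (-Complex.normSq z))

@[fun_prop]
theorem measurable_gaussDensity : Measurable gaussDensity := by
  have : Measurable Complex.normSq := Complex.continuous_normSq.measurable
  unfold gaussDensity; fun_prop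

theorem stdComplexGaussian_eq : stdComplexGaussian = volume.withDensity gaussDensity := by
  have hv : (1 / 2 : ℝ≥0) ≠ 0 := by norm_num
  rw [stdComplexGaussian, gaussianReal_of_var_ne_zero _ hv,
    prod_withDensity (by fun_prop) (by fun_prop), ← Measure.volume_eq_prod]
  have hmp := Complex.volume_preserving_equiv_real_prod.symm
  refine Measure.ext fun s hs => ?_
  rw [MeasurableEquiv.map_apply, withDensity_apply _ (MeasurableEquiv.measurable _ hs),
    withDensity_apply _ hs, ← hmp.setLIntegral_comp_preimage hs measurable_gaussDensity]
  refine lintegral_congr fun p => ?_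
  rw [gaussianPDF, gaussianPDF, ← ENNReal.ofReal_mul (gaussianPDFReal_nonneg _ _ _), gaussDensity]
  congr 1
  have : Complex.normSq (Complex.measurableEquivRealProd.symm p) = p.1 ^ 2 + p.2 ^ 2 := by
    simp [Complex.normSq_apply, Complex.measurableEquivRealProd, sq]
  rw [this, gaussianPDFReal, gaussianPDFReal]
  have h2 : Real.sqrt (2 * Real.pi * ((1 / 2 : ℝ≥0) : ℝ)) = Real.sqrt Real.pi := by
    congr 1; push_cast; ring
  rw [h2, mul_mul_mul_comm, ← Real.exp_add, ← mul_inv, Real.mul_self_sqrt Real.pi_pos.le]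
  congr 2
  push_cast; ring

instance : IsProbabilityMeasure stdComplexGaussian :=
  Measure.isProbabilityMeasure_map (by fun_prop)

open scoped Nat in
/-- The permanent of `J + w • 1`, where `J` is the all-ones matrix. -/
theorem sum_perm_prod_one_add_ite {ι : Type*} [Fintype ι] [DecidableEq ι] (w : ℝ) :
    ∑ σ : Equiv.Perm ι, ∏ i, (1 + if σ i = i then w else 0)
      = ∑ k ∈ Finset.range (Fintype.card ι + 1), ((Fintype.card ι)! : ℝ) / k ! * w ^ k := by
  -- Permutations fixing `t` pointwise are the permutations of its complement. They are the
  -- coefficients that appear when the product is expanded over subsets.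
  have hcard : ∀ t : Finset ι, (Finset.univ.filter fun σ : Equiv.Perm ι => ∀ i ∈ t, σ i = i).card
      = (Fintype.card ι - t.card)! := by
    intro t
    rw [← Fintype.card_subtype]
    have e := Equiv.Perm.subtypeEquivSubtypePerm (fun i => i ∉ t)
    rw [← Fintype.card_congr (e.trans (Equiv.subtypeEquivRight (by simp))), Fintype.card_perm]
    simp [Fintype.card_subtype_compl]
  have hprod : ∀ (σ : Equiv.Perm ι) (t : Finset ι), ∏ i ∈ t, (if σ i = i then w else 0)
      = if ∀ i ∈ t, σ i = i then w ^ t.card else 0 := by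
    intro σ t
    split_ifs with h
    · rw [Finset.prod_congr rfl fun i hi => if_pos (h i hi), Finset.prod_const]
    · push Not at h
      obtain ⟨i, hi, hne⟩ := h
      exact Finset.prod_eq_zero hi (if_neg hne)
  simp_rw [Finset.prod_one_add, hprod]
  rw [Finset.sum_comm]
  have : ∀ t : Finset ι, ∑ σ : Equiv.Perm ι, (if ∀ i ∈ t, σ i = i then w ^ t.card else 0)
      = ((Fintype.card ι - t.card)! : ℝ) * w ^ t.card := by
    intro t
    rw [← Finset.sum_filter, Finset.sum_const, hcard, nsmul_eq_mul]
  simp_rw [this]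
  rw [Finset.sum_powerset_apply_card (fun k => ((Fintype.card ι - k)! : ℝ) * w ^ k),
    Finset.card_univ]
  refine Finset.sum_congr rfl fun k hk => ?_
  have hk' : k ≤ Fintype.card ι := Nat.lt_succ_iff.1 (Finset.mem_range.1 hk)
  rw [nsmul_eq_mul, ← mul_assoc, eq_comm]
  congr 1
  rw [div_eq_iff (by positivity)]
  exact_mod_cast (by rw [← Nat.choose_mul_factorial_mul_factorial hk']; ring)

theorem integral_stdComplexGaussian (f : ℂ → ℂ) :
    ∫ w, f w ∂stdComplexGaussian = ∫ p : ℝ × ℝ, f ⟨p.1, p.2⟩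
        ∂((gaussianReal 0 (1 / 2)).prod (gaussianReal 0 (1 / 2))) := by
  rw [stdComplexGaussian, MeasureTheory.integral_map_equiv]
  rfl

theorem integrable_sq_gaussianReal (v : ℝ≥0) :
    Integrable (fun x : ℝ => x ^ 2) (gaussianReal 0 v) :=
  (memLp_id_gaussianReal 2).integrable_sq

theorem integral_sq_gaussianReal (v : ℝ≥0) : ∫ x : ℝ, x ^ 2 ∂(gaussianReal 0 v) = v := by
  have h := variance_id_gaussianReal (μ := 0) (v := v)
  rw [variance_of_integral_eq_zero aemeasurable_id (by simp)] at h
  simpa using h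

theorem memLp_id_stdComplexGaussian : MemLp (fun w : ℂ => w) 2 stdComplexGaussian := by
  rw [memLp_two_iff_integrable_sq_norm (by fun_prop), stdComplexGaussian,
    integrable_map_equiv]
  have h := (integrable_sq_gaussianReal (1 / 2)).comp_fst (gaussianReal 0 (1 / 2))
  have h' := (integrable_sq_gaussianReal (1 / 2)).comp_snd (gaussianReal 0 (1 / 2))
  refine (h.add h').congr (Eventually.of_forall fun p => ?_)
  change p.1 ^ 2 + p.2 ^ 2 = ‖Complex.measurableEquivRealProd.symm p‖ ^ 2
  rw [← Complex.normSq_eq_norm_sq, Complex.normSq_apply, sq, sq]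
  rfl

theorem integral_id_stdComplexGaussian : ∫ w, w ∂stdComplexGaussian = 0 := by
  have hi : Integrable (fun x : ℝ => x) (gaussianReal 0 (1 / 2)) :=
    (memLp_id_gaussianReal 1).integrable le_rfl
  have h0 : ∫ x : ℝ, x ∂(gaussianReal 0 (1 / 2)) = 0 := by simp
  have hw := memLp_id_stdComplexGaussian.integrable (by norm_num)
  rw [← integral_re_add_im hw, stdComplexGaussian, MeasureTheory.integral_map_equiv,
    MeasureTheory.integral_map_equiv]
  have h1 := integral_fun_fst (μ := gaussianReal 0 (1 / 2)) (ν := gaussianReal 0 (1 / 2))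
    (fun x : ℝ => x)
  have h2 := integral_fun_snd (μ := gaussianReal 0 (1 / 2)) (ν := gaussianReal 0 (1 / 2))
    (fun x : ℝ => x)
  rw [h0] at h1 h2
  have e1 : ∀ p : ℝ × ℝ, RCLike.re (Complex.measurableEquivRealProd.symm p) = p.1 := fun p => rfl
  have e2 : ∀ p : ℝ × ℝ, RCLike.im (Complex.measurableEquivRealProd.symm p) = p.2 := fun p => rfl
  simp only [e1, e2, h1, h2]
  simp

theorem integral_mul_conj_stdComplexGaussian :
    ∫ w, w * (starRingEnd ℂ) w ∂stdComplexGaussian = 1 := by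
  rw [integral_stdComplexGaussian]
  have h := (integrable_sq_gaussianReal (1 / 2)).comp_fst (gaussianReal 0 (1 / 2))
  have h' := (integrable_sq_gaussianReal (1 / 2)).comp_snd (gaussianReal 0 (1 / 2))
  have : ∀ p : ℝ × ℝ, (⟨p.1, p.2⟩ : ℂ) * (starRingEnd ℂ) ⟨p.1, p.2⟩
      = ((p.1 ^ 2 + p.2 ^ 2 : ℝ) : ℂ) := by
    intro p
    rw [Complex.mul_conj, Complex.normSq_apply]; simp [sq]
  simp_rw [this]
  rw [integral_complex_ofReal, integral_add h h',
    integral_fun_fst (fun x : ℝ => x ^ 2), integral_fun_snd (fun x : ℝ => x ^ 2),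
    integral_sq_gaussianReal]
  norm_num

section Row

variable {κ : Type*} [Fintype κ]

theorem memLp_eval_pi_stdComplexGaussian (a : κ) :
    MemLp (fun x : κ → ℂ => x a) 2 (Measure.pi fun _ => stdComplexGaussian) :=
  memLp_id_stdComplexGaussian.comp_measurePreserving (measurePreserving_eval _ a)

theorem integral_eval_pi_stdComplexGaussian (a : κ) :
    ∫ x : κ → ℂ, x a ∂(Measure.pi fun _ => stdComplexGaussian) = 0 := by
  rw [← integral_id_stdComplexGaussian]
  exact integral_comp_eval (μ := fun _ : κ => stdComplexGaussian) (f := fun w => w) (by fun_prop)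

theorem integral_eval_mul_conj_eval [DecidableEq κ] (a b : κ) :
    ∫ x : κ → ℂ, x a * (starRingEnd ℂ) (x b) ∂(Measure.pi fun _ => stdComplexGaussian)
      = if a = b then 1 else 0 := by
  split_ifs with h
  · subst h
    rw [← integral_mul_conj_stdComplexGaussian]
    exact integral_comp_eval (μ := fun _ : κ => stdComplexGaussian)
      (f := fun w => w * (starRingEnd ℂ) w) (Continuous.aestronglyMeasurable (by fun_prop))
  · have hind : iIndepFun (fun (c : κ) (x : κ → ℂ) => x c)
        (Measure.pi fun _ => stdComplexGaussian) :=
      iIndepFun_pi (X := fun _ w => w) (fun _ => by fun_prop)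
    have := (hind.indepFun h).comp (φ := fun w : ℂ => w) (ψ := starRingEnd ℂ)
      measurable_id Complex.continuous_conj.measurable
    have h2 := this.integral_fun_mul_eq_mul_integral
      (Measurable.aestronglyMeasurable (measurable_pi_apply a))
      (Continuous.aestronglyMeasurable (by fun_prop))
    simp only [Function.comp_def] at h2
    rw [h2, integral_eval_pi_stdComplexGaussian, zero_mul]

theorem integrable_affine_mul_conj_affine (a b : κ) (p q : ℂ) :
    Integrable (fun x : κ → ℂ => (p - x a) * (starRingEnd ℂ) (q - x b))
      (Measure.pi fun _ => stdComplexGaussian) :=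
  MemLp.integrable_mul (p := 2) (q := 2) ((memLp_const p).sub (memLp_eval_pi_stdComplexGaussian a))
    (((memLp_const q).sub (memLp_eval_pi_stdComplexGaussian b)).star)

/-- Entries are centred and uncorrelated with unit variance, so the cross terms vanish and only the
deterministic part and the covariance survive. -/
theorem integral_affine_mul_conj_affine [DecidableEq κ] (a b : κ) (p q : ℂ) :
    ∫ x : κ → ℂ, (p - x a) * (starRingEnd ℂ) (q - x b) ∂(Measure.pi fun _ => stdComplexGaussian)
      = p * (starRingEnd ℂ) q + if a = b then 1 else 0 := by
  have ha : Integrable (fun x : κ → ℂ => x a) (Measure.pi fun _ => stdComplexGaussian) :=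
    (memLp_eval_pi_stdComplexGaussian a).integrable (by norm_num)
  have hb : Integrable (fun x : κ → ℂ => (starRingEnd ℂ) (x b))
      (Measure.pi fun _ => stdComplexGaussian) :=
    ((memLp_eval_pi_stdComplexGaussian b).star).integrable (by norm_num)
  have hab : Integrable (fun x : κ → ℂ => x a * (starRingEnd ℂ) (x b))
      (Measure.pi fun _ => stdComplexGaussian) := by
    simpa using integrable_affine_mul_conj_affine a b 0 0
  have hb0 : ∫ x : κ → ℂ, (starRingEnd ℂ) (x b) ∂(Measure.pi fun _ => stdComplexGaussian) = 0 := by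
    rw [integral_conj, integral_eval_pi_stdComplexGaussian, map_zero]
  have hexp : ∀ x : κ → ℂ, (p - x a) * (starRingEnd ℂ) (q - x b)
      = p * (starRingEnd ℂ) q - p * (starRingEnd ℂ) (x b) - (starRingEnd ℂ) q * x a
        + x a * (starRingEnd ℂ) (x b) := by
    intro x; rw [map_sub]; ring
  simp_rw [hexp]
  rw [integral_add _ hab, integral_sub _ (ha.const_mul _), integral_sub (integrable_const _)
    (hb.const_mul _), integral_const_mul p fun x : κ → ℂ => (starRingEnd ℂ) (x b),
    integral_const_mul ((starRingEnd ℂ) q) fun x : κ → ℂ => x a, hb0,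
    integral_eval_pi_stdComplexGaussian,
    integral_eval_mul_conj_eval]
  · simp
  · exact (integrable_const _).sub (hb.const_mul _)
  · exact ((integrable_const _).sub (hb.const_mul _)).sub (ha.const_mul _)

end Row

/-! ### The second moment of a shifted Ginibre determinant. -/

section Det

variable {ι κ : Type*} [Fintype ι] [DecidableEq ι] [Fintype κ] [DecidableEq κ]

open scoped Nat in
/-- The second moment of the shifted determinant of a complex Ginibre matrix. The matrix is a
square block, given by `j : ι → κ`, of a rectangular array of independent entries. -/
theorem integral_normSq_det_sub (j : ι → κ) (hj : Function.Injective j) (z : ℂ) :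
    Integrable (fun N : ι → κ → ℂ =>
        Complex.normSq (Matrix.det (Matrix.of fun a b => (if a = b then z else 0) - N a (j b))))
        (Measure.pi fun _ => Measure.pi fun _ => stdComplexGaussian) ∧
      ∫ N : ι → κ → ℂ,
        Complex.normSq (Matrix.det (Matrix.of fun a b => (if a = b then z else 0) - N a (j b)))
        ∂(Measure.pi fun _ => Measure.pi fun _ => stdComplexGaussian)
      = ∑ k ∈ Finset.range (Fintype.card ι + 1),
          ((Fintype.card ι)! : ℝ) / k ! * Complex.normSq z ^ k := by
  set μ : Measure (ι → κ → ℂ) := Measure.pi fun _ => Measure.pi fun _ => stdComplexGaussian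
  let D : ι → ι → ℂ := fun a b => if a = b then z else 0
  let F : Equiv.Perm ι → Equiv.Perm ι → ι → (κ → ℂ) → ℂ := fun σ τ i x =>
    (D i (σ i) - x (j (σ i))) * (starRingEnd ℂ) (D i (τ i) - x (j (τ i)))
  have hexp : ∀ N : ι → κ → ℂ,
      ((Complex.normSq (Matrix.det (Matrix.of fun a b => D a b - N a (j b))) : ℝ) : ℂ)
      = ∑ σ : Equiv.Perm ι, ∑ τ : Equiv.Perm ι,
          ((σ.sign : ℤ) : ℂ) * ((τ.sign : ℤ) : ℂ) * ∏ i, F σ τ i (N i) := by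
    intro N
    rw [← Complex.mul_conj, ← Matrix.det_transpose, Matrix.det_apply', map_sum, Finset.sum_mul_sum]
    refine Finset.sum_congr rfl fun σ _ => Finset.sum_congr rfl fun τ _ => ?_
    rw [map_mul, map_prod, map_intCast, mul_mul_mul_comm, ← Finset.prod_mul_distrib]
    rfl
  have hint : ∀ σ τ : Equiv.Perm ι, Integrable (fun N : ι → κ → ℂ => ((σ.sign : ℤ) : ℂ) *
      ((τ.sign : ℤ) : ℂ) * ∏ i, F σ τ i (N i)) μ := fun σ τ =>
    (Integrable.fintype_prod fun i => integrable_affine_mul_conj_affine _ _ _ _).const_mul _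
  have hval : ∀ σ τ : Equiv.Perm ι, ∫ N : ι → κ → ℂ, ((σ.sign : ℤ) : ℂ) *
      ((τ.sign : ℤ) : ℂ) * ∏ i, F σ τ i (N i) ∂μ
      -- Rows are independent, so each term of the double Leibniz expansion factors over the rows.
      -- The diagonal terms add up to the permanent of $J+|z|^2 I$.
      = if σ = τ then ((∏ i, (1 + if σ i = i then Complex.normSq z else 0) : ℝ) : ℂ) else 0 := by
    intro σ τ
    rw [integral_const_mul, integral_fintype_prod_eq_prod (f := F σ τ)]
    simp only [F, integral_affine_mul_conj_affine]
    split_ifs with h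
    · subst h
      have hs : ((σ.sign : ℤ) : ℂ) * ((σ.sign : ℤ) : ℂ) = 1 := by
        rw [← Int.cast_mul, Int.units_coe_mul_self, Int.cast_one]
      rw [hs, one_mul]
      push_cast
      refine Finset.prod_congr rfl fun i _ => ?_
      by_cases hi : σ i = i
      · simp [D, hi, Complex.mul_conj, add_comm]
      · simp [D, hi, Ne.symm hi]
    -- In row `i` the two entries are uncorrelated, since `j` is injective. At most one of them lies
    -- on the diagonal, so the product of the means vanishes as well.
    · obtain ⟨i, hi⟩ : ∃ i, σ i ≠ τ i := by
        by_contra hc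
        push Not at hc
        exact h (Equiv.ext hc)
      rw [Finset.prod_eq_zero (Finset.mem_univ i), mul_zero]
      rw [if_neg (fun hc => hi (hj hc)), add_zero]
      by_cases h1 : i = σ i
      · have h2 : i ≠ τ i := fun h2 => hi (h1.symm.trans h2)
        simp [D, h2]
      · simp [D, h1]
  have hintC : Integrable (fun N : ι → κ → ℂ =>
      ((Complex.normSq (Matrix.det (Matrix.of fun a b => D a b - N a (j b))) : ℝ) : ℂ)) μ := by
    simp_rw [hexp]
    exact integrable_finsetSum _ fun σ _ => integrable_finsetSum _ fun τ _ => hint σ τ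
  refine ⟨by simpa using hintC.re, ?_⟩
  rw [← sum_perm_prod_one_add_ite]
  apply Complex.ofReal_injective
  rw [← integral_complex_ofReal]
  change ∫ N : ι → κ → ℂ,
      ((Complex.normSq (Matrix.det (Matrix.of fun a b => D a b - N a (j b))) : ℝ) : ℂ) ∂μ = _
  simp_rw [hexp]
  rw [integral_finsetSum _ fun σ _ => integrable_finsetSum _ fun τ _ => hint σ τ]
  simp_rw [integral_finsetSum _ fun τ _ => hint _ τ, hval]
  simp

open scoped Nat in
theorem lintegral_normSq_det_sub (j : ι → κ) (hj : Function.Injective j) (z : ℂ) :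
    ∫⁻ N : ι → κ → ℂ, ENNReal.ofReal
        (Complex.normSq (Matrix.det (Matrix.of fun a b => (if a = b then z else 0) - N a (j b))))
        ∂(Measure.pi fun _ => Measure.pi fun _ => stdComplexGaussian)
      = ENNReal.ofReal (∑ k ∈ Finset.range (Fintype.card ι + 1),
          ((Fintype.card ι)! : ℝ) / k ! * Complex.normSq z ^ k) := by
  obtain ⟨h1, h2⟩ := integral_normSq_det_sub j hj z
  rw [← h2, ofReal_integral_eq_lintegral_ofReal h1
    (Eventually.of_forall fun _ => Complex.normSq_nonneg _)]

end Det

/-! ### Deflation of a left eigenvector by a unitary conjugation. -/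

section Deflation

variable {ι : Type*} [Fintype ι] [DecidableEq ι]

open Matrix

theorem trace_conjTranspose_mul_self_eq_sum_normSq {α β : Type*} [Fintype α] [Fintype β]
    (A : Matrix α β ℂ) : (Aᴴ * A).trace = ((∑ i, ∑ j, Complex.normSq (A i j) : ℝ) : ℂ) := by
  rw [Finset.sum_comm, Matrix.trace]
  push_cast
  refine Finset.sum_congr rfl fun j _ => ?_
  rw [diag_apply, mul_apply]
  refine Finset.sum_congr rfl fun i _ => ?_
  rw [conjTranspose_apply, mul_comm, ← Complex.mul_conj]; rfl

/-- The matrix `1 + v* v` has a Hermitian square root. -/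
theorem exists_isHermitian_mul_self_eq_one_add (v : Matrix Unit ι ℂ) :
    ∃ R : Matrix ι ι ℂ, R.IsHermitian ∧ R * R = 1 + vᴴ * v := by
  set s : ℝ := ∑ i, Complex.normSq (v () i)
  have hs0 : 0 ≤ s := Finset.sum_nonneg fun i _ => Complex.normSq_nonneg _
  have hvv : v * vᴴ = (s : ℂ) • 1 := by
    ext a b
    simp [mul_apply, s, Complex.mul_conj]
  have hPP : (vᴴ * v) * (vᴴ * v) = (s : ℂ) • (vᴴ * v) := by
    rw [Matrix.mul_assoc, ← Matrix.mul_assoc v, hvv]; simp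
  -- With $P=v^*v$ and $P^2=sP$, the square of $1+\alpha P$ is $1+(2\alpha+s\alpha^2)P$. This root
  -- of $s\alpha^2+2\alpha=1$ is written so that $s=0$ needs no separate case.
  set α : ℝ := 1 / (1 + Real.sqrt (1 + s))
  have hα : 2 * α + α ^ 2 * s = 1 := by
    have h := Real.sq_sqrt (show 0 ≤ 1 + s by linarith)
    have h0 := Real.sqrt_nonneg (1 + s)
    simp only [α]
    field_simp
    nlinarith
  refine ⟨1 + (α : ℂ) • (vᴴ * v), ?_, ?_⟩
  · rw [IsHermitian, conjTranspose_add, conjTranspose_one, conjTranspose_smul]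
    simp
  · have : (2 * α + α ^ 2 * s : ℂ) = 1 := by exact_mod_cast hα
    calc (1 + (α : ℂ) • (vᴴ * v)) * (1 + (α : ℂ) • (vᴴ * v))
        = 1 + (2 * α + α ^ 2 * s : ℂ) • (vᴴ * v) := by
          rw [mul_add, mul_one, add_mul, one_mul, smul_mul_smul_comm, hPP]
          module
      _ = 1 + vᴴ * v := by rw [this, one_smul]

/-- Deflation of the left eigenvector `(v, 1)` with eigenvalue `z`: an affine change of the free
entries `W` which turns the matrix into a block triangular one by a unitary conjugation. -/
theorem exists_deflation (v : ι → ℂ) (z : ℂ) :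
    ∃ (R : Matrix ι ι ℂ) (H : Matrix (ι ⊕ Unit) (ι ⊕ Unit) ℂ) (b : Matrix ι (ι ⊕ Unit) ℂ),
      Complex.normSq R.det = 1 + ∑ i, Complex.normSq (v i) ∧ Complex.normSq H.det = 1 ∧
      ∀ W : Matrix ι (ι ⊕ Unit) ℂ,
        (∑ i, ∑ j, Complex.normSq ((R * W * H - b) i j) + Complex.normSq z
          = ∑ i, ∑ j, Complex.normSq (W i j)
            + ∑ j, Complex.normSq (z * (Sum.elim v 1 : ι ⊕ Unit → ℂ) j - (v ᵥ* W) j)) ∧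
        (Matrix.of fun i j => (if i = j then z else 0) - (R * W * H - b) i (Sum.inl j)).det
          = (z • (1 : Matrix ι ι ℂ) - W.toCols₁
              + vecMulVec (fun i => W i (Sum.inr ())) v).det := by
  set V : Matrix Unit ι ℂ := replicateRow Unit v
  set s : ℝ := ∑ i, Complex.normSq (v i)
  have hs0 : 0 ≤ s := Finset.sum_nonneg fun i _ => Complex.normSq_nonneg _
  have hvv : V * Vᴴ = (s : ℂ) • 1 := by
    ext a b
    simp [mul_apply, s, V, Complex.mul_conj]
  obtain ⟨R, hR, hRR⟩ := exists_isHermitian_mul_self_eq_one_add V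
  have hdetS : (1 + Vᴴ * V).det = ((1 + s : ℝ) : ℂ) := by
    rw [det_one_add_mul_comm, hvv]; simp [det_unique]
  have hdetR : R.det * R.det = ((1 + s : ℝ) : ℂ) := by rw [← det_mul, hRR, hdetS]
  have hRu : IsUnit R.det := by
    refine isUnit_iff_ne_zero.2 fun h => ?_
    rw [h, zero_mul] at hdetR
    have : (1 + s : ℝ) = 0 := by exact_mod_cast hdetR.symm
    linarith
  have hRi : R * R⁻¹ = 1 := mul_nonsing_inv R hRu
  have hiR : R⁻¹ * R = 1 := nonsing_inv_mul R hRu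
  have hRiH : (R⁻¹)ᴴ = R⁻¹ := hR.inv
  set t : ℝ := Real.sqrt (1 + s)
  have ht : t * t = 1 + s := Real.mul_self_sqrt (by linarith)
  have ht0 : (t : ℂ) ≠ 0 := by
    intro h
    have : t = 0 := by exact_mod_cast h
    rw [this] at ht; linarith
  -- The columns of `K` span the kernel of the row `u` $=(v,1)$. Normalising them by $R^{-1}$ and
  -- adjoining $u^*/t$ gives the unitary matrix `H`.
  set K : Matrix (ι ⊕ Unit) ι ℂ := fromRows 1 (-V)
  set u : Matrix Unit (ι ⊕ Unit) ℂ := fromCols V 1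
  have huK : u * K = 0 := by simp [u, K, fromCols_mul_fromRows]
  have hKK : Kᴴ * K = R * R := by
    rw [hRR]
    simp [K, conjTranspose_fromRows_eq_fromCols_conjTranspose, fromCols_mul_fromRows]
  have huu : u * uᴴ = ((t * t : ℝ) : ℂ) • 1 := by
    rw [ht]
    simp [u, conjTranspose_fromCols_eq_fromRows_conjTranspose, fromCols_mul_fromRows, hvv,
      add_smul, add_comm]
  set H : Matrix (ι ⊕ Unit) (ι ⊕ Unit) ℂ := fromCols (K * R⁻¹) ((t : ℂ)⁻¹ • uᴴ)
  have hHH : Hᴴ * H = 1 := by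
    have hKu : Kᴴ * uᴴ = 0 := by rw [← conjTranspose_mul, huK, conjTranspose_zero]
    rw [conjTranspose_fromCols_eq_fromRows_conjTranspose, fromRows_mul_fromCols,
      ← fromBlocks_one]
    congr 1
    · rw [conjTranspose_mul, hRiH, Matrix.mul_assoc, ← Matrix.mul_assoc Kᴴ, hKK,
        Matrix.mul_assoc, hRi, Matrix.mul_one, hiR]
    · rw [conjTranspose_mul, Matrix.mul_smul, Matrix.mul_assoc, hKu]; simp
    · rw [conjTranspose_smul, conjTranspose_conjTranspose, smul_mul, ← Matrix.mul_assoc, huK]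
      simp
    · rw [conjTranspose_smul, conjTranspose_conjTranspose, smul_mul, Matrix.mul_smul, huu]
      ext
      simp [ht0]
  have hHH' : H * Hᴴ = 1 := mul_eq_one_comm.1 hHH
  refine ⟨R, H, z • (R⁻¹ * Vᴴ * u * H), ?_, ?_, fun W => ⟨?_, ?_⟩⟩
  · have := congrArg Complex.normSq hdetR
    rw [Complex.normSq_mul, Complex.normSq_ofReal] at this
    exact (mul_self_inj (Complex.normSq_nonneg _) (by linarith)).1 this
  · have := congrArg det hHH
    rw [det_mul, det_conjTranspose, det_one] at this
    have h2 : ((Complex.normSq H.det : ℝ) : ℂ) = 1 := by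
      rw [← Complex.mul_conj, mul_comm]; exact this
    exact_mod_cast h2
  -- `X` is the completion of `W` with `u * X = z • u`. In $H^*XH$ the upper rows are `N` and the
  -- last row has squared norm $|z|^2$. The identity is the invariance of the Frobenius norm under
  -- this conjugation.
  · set B : Matrix Unit (ι ⊕ Unit) ℂ := z • u - V * W
    set X : Matrix (ι ⊕ Unit) (ι ⊕ Unit) ℂ := fromRows W B
    set N := R * W * H - z • (R⁻¹ * Vᴴ * u * H)
    have huX : u * X = z • u := by
      simp [u, X, B, fromCols_mul_fromRows]
    have hKX : Kᴴ * X = R * R * W - z • (Vᴴ * u) := by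
      rw [hRR]
      simp [K, X, B, conjTranspose_fromRows_eq_fromCols_conjTranspose, fromCols_mul_fromRows,
        Matrix.mul_sub, Matrix.add_mul, Matrix.mul_assoc]
      abel
    have hY : Hᴴ * X * H = fromRows N (((t : ℂ)⁻¹ * z) • (u * H)) := by
      rw [show Hᴴ = fromRows (R⁻¹ * Kᴴ) ((t : ℂ)⁻¹ • u) by
        rw [conjTranspose_fromCols_eq_fromRows_conjTranspose, conjTranspose_mul, hRiH,
          conjTranspose_smul, conjTranspose_conjTranspose]; simp]
      rw [fromRows_mul, fromRows_mul]
      congr 1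
      · rw [Matrix.mul_assoc R⁻¹, hKX, Matrix.mul_sub, Matrix.sub_mul, Matrix.mul_assoc R,
          ← Matrix.mul_assoc R⁻¹ R, hiR, Matrix.one_mul, Matrix.mul_smul, Matrix.smul_mul]
        simp only [N, Matrix.mul_assoc]
      · rw [smul_mul, huX, smul_mul, smul_mul, smul_smul]
    have htr : ∀ A : Matrix (ι ⊕ Unit) (ι ⊕ Unit) ℂ,
        ((Hᴴ * A * H)ᴴ * (Hᴴ * A * H)).trace = (Aᴴ * A).trace := by
      intro A
      have : (Hᴴ * A * H)ᴴ * (Hᴴ * A * H) = Hᴴ * (Aᴴ * A * H) := by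
        rw [conjTranspose_mul, conjTranspose_mul, conjTranspose_conjTranspose]
        simp only [Matrix.mul_assoc]
        rw [← Matrix.mul_assoc H, hHH', Matrix.one_mul]
      rw [this, trace_mul_comm, Matrix.mul_assoc, hHH', Matrix.mul_one]
    have hlast : ∑ j, Complex.normSq ((((t : ℂ)⁻¹ * z) • (u * H)) () j) = Complex.normSq z := by
      apply Complex.ofReal_injective
      have h1 := trace_conjTranspose_mul_self_eq_sum_normSq (((t : ℂ)⁻¹ * z) • (u * H))
      rw [Fintype.sum_unique] at h1
      rw [show (default : Unit) = () from rfl] at h1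
      rw [← h1, trace_mul_comm, conjTranspose_smul, conjTranspose_mul, smul_mul, Matrix.mul_smul,
        Matrix.mul_assoc, ← Matrix.mul_assoc H, hHH', Matrix.one_mul, huu]
      simp only [trace_smul, trace_one, Fintype.card_unit, smul_eq_mul, star_mul', star_inv₀,
        Complex.star_def, Complex.conj_ofReal, ← Complex.mul_conj]
      push_cast
      field_simp
    have hX := htr X
    rw [hY, trace_conjTranspose_mul_self_eq_sum_normSq,
      trace_conjTranspose_mul_self_eq_sum_normSq] at hX
    have hX' := Complex.ofReal_injective hX
    rw [Fintype.sum_sum_type, Fintype.sum_sum_type, Fintype.sum_unique (ι := Unit),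
      Fintype.sum_unique (ι := Unit)] at hX'
    simp only [X, fromRows_apply_inl, fromRows_apply_inr] at hX'
    rw [show (default : Unit) = () from rfl, hlast] at hX'
    rw [hX']
    refine congrArg _ (Finset.sum_congr rfl fun j _ => congrArg _ ?_)
    cases j <;> simp [B, u, V, mul_apply, vecMul, dotProduct]
  -- The translation term disappears from the first columns because $uK=0$. What remains is similar
  -- to $WK=A-cv$, so the determinant does not see `R`.
  · have h1 : (R * W * H - z • (R⁻¹ * Vᴴ * u * H)).toCols₁ = R * (W * K) * R⁻¹ := by
      have hW : ∀ {γ : Type _} (A : Matrix γ (ι ⊕ Unit) ℂ), (A * H).toCols₁ = A * (K * R⁻¹) := by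
        intro γ A
        simp [H, mul_fromCols]
      rw [show (R * W * H - z • (R⁻¹ * Vᴴ * u * H)) = (R * W - z • (R⁻¹ * Vᴴ * u)) * H by
        rw [Matrix.sub_mul, smul_mul], hW, Matrix.sub_mul, smul_mul,
        Matrix.mul_assoc _ u, ← Matrix.mul_assoc u, huK]
      simp [Matrix.mul_assoc]
    have h2 : W * K = W.toCols₁ - vecMulVec (fun i => W i (Sum.inr ())) v := by
      conv_lhs => rw [← fromCols_toCols W]
      rw [fromCols_mul_fromRows, Matrix.mul_one, Matrix.mul_neg, ← sub_eq_add_neg]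
      congr 1
      ext i j
      simp [mul_apply, V, vecMulVec_apply]
    have h3 : (Matrix.of fun i j => (if i = j then z else 0)
        - (R * W * H - z • (R⁻¹ * Vᴴ * u * H)) i (Sum.inl j))
        = R * (z • (1 : Matrix ι ι ℂ) - W * K) * R⁻¹ := by
      rw [Matrix.mul_sub, Matrix.sub_mul, ← h1, Matrix.mul_smul, Matrix.mul_one, smul_mul, hRi]
      ext i j
      simp [one_apply, toCols₁_apply]
    rw [h3, det_mul, det_mul, mul_right_comm, ← det_mul, hRi, det_one, one_mul, h2, sub_add]

end Deflation

/-! ### Jacobians of complex linear maps. -/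

theorem lintegral_eq_normSq_det_mul_lintegral_comp {E : Type*} [NormedAddCommGroup E]
    [NormedSpace ℂ E] [NormedSpace ℝ E] [IsScalarTower ℝ ℂ E] [FiniteDimensional ℂ E]
    [FiniteDimensional ℝ E]
    [MeasurableSpace E] [BorelSpace E] (μ : Measure E) [μ.IsAddHaarMeasure] (L : E →ₗ[ℂ] E)
    (hL : L.det ≠ 0) {f : E → ℝ≥0∞} (hf : Measurable f) :
    ∫⁻ x, f x ∂μ = ENNReal.ofReal (Complex.normSq L.det) * ∫⁻ x, f (L x) ∂μ := by
  have hdet : (L.restrictScalars ℝ).det = Complex.normSq L.det := by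
    rw [LinearMap.det_restrictScalars, Algebra.norm_complex_apply]
  have hpos : 0 < Complex.normSq L.det := Complex.normSq_pos.2 hL
  have hmap := Measure.map_linearMap_addHaar_eq_smul_addHaar μ (f := L.restrictScalars ℝ)
    (by rw [hdet]; exact hpos.ne')
  have hcont : Continuous L := LinearMap.continuous_of_finiteDimensional L
  have : ∫⁻ x, f (L x) ∂μ = ∫⁻ y, f y ∂(μ.map (L.restrictScalars ℝ)) :=
    (lintegral_map hf hcont.measurable).symm
  rw [this, hmap, lintegral_smul_measure, hdet, smul_eq_mul, ← mul_assoc,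
    ← ENNReal.ofReal_mul hpos.le, abs_of_pos (inv_pos.2 hpos), mul_inv_cancel₀ hpos.ne',
    ENNReal.ofReal_one, one_mul]

section MatrixMul

open Matrix

variable {ι κ : Type*} [Fintype ι] [Fintype κ]

/-- The map `W ↦ R * W * H` on rectangular matrices. -/
noncomputable def mulLeftRight (R : Matrix ι ι ℂ) (H : Matrix κ κ ℂ) :
    (ι → κ → ℂ) →ₗ[ℂ] (ι → κ → ℂ) where
  toFun W := R * (Matrix.of W) * H
  map_add' A B := by
    change R * (of A + of B) * H = R * of A * H + R * of B * H
    rw [Matrix.mul_add, Matrix.add_mul]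
  map_smul' c A := by
    change R * (c • of A) * H = c • (R * of A * H)
    rw [Matrix.mul_smul, Matrix.smul_mul]

theorem mulLeftRight_apply (R : Matrix ι ι ℂ) (H : Matrix κ κ ℂ) (W : ι → κ → ℂ) :
    mulLeftRight R H W = R * (Matrix.of W) * H := rfl

variable [DecidableEq ι] [DecidableEq κ]

/-- Left multiplication acts separately on each column by `R`, and right multiplication separately
on each row by the transpose of `H`. -/
theorem det_mulLeftRight (R : Matrix ι ι ℂ) (H : Matrix κ κ ℂ) :
    (mulLeftRight R H).det = R.det ^ Fintype.card κ * H.det ^ Fintype.card ι := by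
  have hright : (mulLeftRight (1 : Matrix ι ι ℂ) H).det = H.det ^ Fintype.card ι := by
    have : mulLeftRight (1 : Matrix ι ι ℂ) H
        = LinearMap.pi fun i => (Matrix.toLin' Hᵀ).comp (LinearMap.proj i) := by
      refine LinearMap.ext fun W => ?_
      funext i j
      rw [mulLeftRight_apply, Matrix.one_mul, Matrix.mul_apply]
      simp [mulVec, dotProduct, mul_comm]
    rw [this, LinearMap.det_pi]
    simp
  have hleft : (mulLeftRight R (1 : Matrix κ κ ℂ)).det = R.det ^ Fintype.card κ := by
    let e : (ι → κ → ℂ) ≃ₗ[ℂ] (κ → ι → ℂ) := Matrix.transposeLinearEquiv ι κ ℂ ℂ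
    rw [← LinearMap.det_conj _ e]
    have : (e : (ι → κ → ℂ) →ₗ[ℂ] (κ → ι → ℂ)) ∘ₗ mulLeftRight R (1 : Matrix κ κ ℂ) ∘ₗ
        (e.symm : (κ → ι → ℂ) →ₗ[ℂ] (ι → κ → ℂ))
        = LinearMap.pi fun i => (Matrix.toLin' R).comp (LinearMap.proj i) := by
      refine LinearMap.ext fun W => ?_
      funext i j
      rw [LinearMap.comp_apply, LinearMap.comp_apply, mulLeftRight_apply, Matrix.mul_one]
      rfl
    rw [this, LinearMap.det_pi]
    simp
  have hcomp : mulLeftRight R H = (mulLeftRight (1 : Matrix ι ι ℂ) H).comp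
      (mulLeftRight R (1 : Matrix κ κ ℂ)) := by
    refine LinearMap.ext fun W => ?_
    rw [LinearMap.comp_apply, mulLeftRight_apply, mulLeftRight_apply, mulLeftRight_apply,
      Matrix.mul_one, Matrix.one_mul]
    rfl
  rw [hcomp, LinearMap.det_comp, hright, hleft, mul_comm]

end MatrixMul

/-! ### Explicit Gaussian and Gamma integrals. -/

theorem lintegral_exp_neg_mul_normSq {t : ℝ} (ht : 0 < t) :
    ∫⁻ w : ℂ, ENNReal.ofReal (Real.exp (-(t * Complex.normSq w))) = ENNReal.ofReal (Real.pi / t) := by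
  have h := GaussianFourier.integral_rexp_neg_mul_sq_norm (V := ℂ) ht
  simp only [Complex.finrank_real_complex, Nat.cast_ofNat, div_self (two_ne_zero (α := ℝ)),
    Real.rpow_one] at h
  rw [← h, ofReal_integral_eq_lintegral_ofReal _ (Eventually.of_forall fun _ => (Real.exp_pos _).le)]
  · simp_rw [Complex.normSq_eq_norm_sq, neg_mul]
  · refine Integrable.of_integral_ne_zero ?_
    rw [h]; positivity

theorem lintegral_exp_neg_mul_sum_normSq {ι : Type*} [Fintype ι] {t : ℝ} (ht : 0 < t) :
    ∫⁻ v : ι → ℂ, ENNReal.ofReal (Real.exp (-(t * ∑ i, Complex.normSq (v i))))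
      = ENNReal.ofReal ((Real.pi / t) ^ Fintype.card ι) := by
  have : ∀ v : ι → ℂ, ENNReal.ofReal (Real.exp (-(t * ∑ i, Complex.normSq (v i))))
      = ∏ i, ENNReal.ofReal (Real.exp (-(t * Complex.normSq (v i)))) := by
    intro v
    rw [← ENNReal.ofReal_prod_of_nonneg fun _ _ => (Real.exp_pos _).le, ← Real.exp_sum,
      Finset.mul_sum, Finset.sum_neg_distrib]
  simp_rw [this]
  rw [volume_pi, lintegral_fintype_prod_eq_prod
    (fun _ w => ENNReal.ofReal (Real.exp (-(t * Complex.normSq w))))]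
  · simp_rw [lintegral_exp_neg_mul_normSq ht]
    rw [Finset.prod_const, Finset.card_univ, ENNReal.ofReal_pow (by positivity)]
  · intro i
    have := Complex.continuous_normSq.measurable
    fun_prop

open scoped Nat in
theorem lintegral_pow_mul_exp_neg_mul_Ioi (k : ℕ) {T : ℝ} (hT : 0 < T) :
    ∫⁻ t in Set.Ioi (0 : ℝ), ENNReal.ofReal (t ^ k * Real.exp (-(T * t)))
      = ENNReal.ofReal (k ! * (T⁻¹) ^ (k + 1)) := by
  have h := Real.integral_rpow_mul_exp_neg_mul_Ioi (a := k + 1) (r := T) (by positivity) hT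
  rw [Real.Gamma_nat_eq_factorial, add_sub_cancel_right, one_div, mul_comm] at h
  have h' : ((T⁻¹ : ℝ) ^ ((k : ℝ) + 1)) = (T⁻¹) ^ (k + 1) := by
    rw [← Real.rpow_natCast]; push_cast; rfl
  rw [h'] at h
  simp_rw [Real.rpow_natCast] at h
  rw [← h, ofReal_integral_eq_lintegral_ofReal]
  · refine Integrable.of_integral_ne_zero ?_
    rw [h]; positivity
  · filter_upwards [ae_restrict_mem measurableSet_Ioi] with t (ht : 0 < t)
    positivity

open scoped Nat in
-- The power $T^{-(m+1)}$ is a Gamma integral of $t^me^{-Tt}$. After Tonelli the Gaussian integral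
-- over `v` gives $(\pi/t)^m$, which cancels $t^m$ and leaves $\int_0^\infty e^{-t}\,dt=1$.
theorem lintegral_inv_one_add_sum_normSq_pow {ι : Type*} [Fintype ι] :
    ∫⁻ v : ι → ℂ, ENNReal.ofReal ((1 + ∑ i, Complex.normSq (v i))⁻¹ ^ (Fintype.card ι + 1))
      = ENNReal.ofReal (Real.pi ^ Fintype.card ι / (Fintype.card ι)!) := by
  set m := Fintype.card ι
  have hmeas : Measurable fun v : ι → ℂ => ∑ i, Complex.normSq (v i) := by
    have := Complex.continuous_normSq.measurable
    fun_prop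
  have h1 : ∀ v : ι → ℂ, ENNReal.ofReal ((1 + ∑ i, Complex.normSq (v i))⁻¹ ^ (m + 1))
      = ENNReal.ofReal (m ! : ℝ)⁻¹ * ∫⁻ t in Set.Ioi (0 : ℝ), ENNReal.ofReal
          (t ^ m * Real.exp (-((1 + ∑ i, Complex.normSq (v i)) * t))) := by
    intro v
    have hT : 0 < 1 + ∑ i, Complex.normSq (v i) := by
      have := Finset.sum_nonneg fun i (_ : i ∈ Finset.univ) => Complex.normSq_nonneg (v i)
      linarith
    rw [lintegral_pow_mul_exp_neg_mul_Ioi _ hT, ← ENNReal.ofReal_mul (by positivity),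
      ← mul_assoc, inv_mul_cancel₀ (by positivity), one_mul]
  simp_rw [h1]
  rw [lintegral_const_mul _ (by fun_prop), lintegral_lintegral_swap (by fun_prop)]
  have h2 : ∀ t ∈ Set.Ioi (0 : ℝ), ∫⁻ v : ι → ℂ, ENNReal.ofReal
      (t ^ m * Real.exp (-((1 + ∑ i, Complex.normSq (v i)) * t)))
      = ENNReal.ofReal (Real.pi ^ m) * ENNReal.ofReal (t ^ 0 * Real.exp (-(1 * t))) := by
    intro t (ht : 0 < t)
    have : ∀ v : ι → ℂ, ENNReal.ofReal (t ^ m * Real.exp (-((1 + ∑ i, Complex.normSq (v i)) * t)))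
        = ENNReal.ofReal (t ^ m * Real.exp (-t)) *
          ENNReal.ofReal (Real.exp (-(t * ∑ i, Complex.normSq (v i)))) := by
      intro v
      rw [← ENNReal.ofReal_mul (by positivity), mul_assoc, ← Real.exp_add]
      congr 3; ring
    simp_rw [this]
    rw [lintegral_const_mul _ (by fun_prop), lintegral_exp_neg_mul_sum_normSq ht,
      ← ENNReal.ofReal_mul (by positivity), ← ENNReal.ofReal_mul (by positivity)]
    congr 1
    rw [div_pow, pow_zero, one_mul, one_mul]
    field_simp
    simp [m]
  rw [setLIntegral_congr_fun measurableSet_Ioi h2, lintegral_const_mul _ (by fun_prop),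
    lintegral_pow_mul_exp_neg_mul_Ioi 0 one_pos, ← ENNReal.ofReal_mul (by positivity),
    ← ENNReal.ofReal_mul (by positivity)]
  congr 1
  simp [div_eq_inv_mul]

/-! ### The Gaussian weight of matrices with a prescribed left eigenvector. -/

theorem prod_gaussDensity {α : Type*} (s : Finset α) (w : α → ℂ) :
    ∏ i ∈ s, gaussDensity (w i) = ENNReal.ofReal
      ((Real.pi⁻¹) ^ s.card * Real.exp (-∑ i ∈ s, Complex.normSq (w i))) := by
  have := Real.pi_pos
  simp_rw [gaussDensity]
  rw [← ENNReal.ofReal_prod_of_nonneg fun _ _ => by positivity, Finset.prod_mul_distrib,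
    Finset.prod_const, ← Real.exp_sum, Finset.sum_neg_distrib]

theorem prod_prod_gaussDensity {α β : Type*} [Fintype α] [Fintype β] (w : α → β → ℂ) :
    ∏ i, ∏ j, gaussDensity (w i j) = ENNReal.ofReal
      ((Real.pi⁻¹) ^ (Fintype.card α * Fintype.card β) *
        Real.exp (-∑ i, ∑ j, Complex.normSq (w i j))) := by
  rw [← Fintype.prod_prod_type', prod_gaussDensity, ← Fintype.sum_prod_type', Finset.card_univ,
    Fintype.card_prod]

instance {κ : Type*} [Fintype κ] :
    SigmaFinite ((volume : Measure (κ → ℂ)).withDensity fun x => ∏ j, gaussDensity (x j)) :=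
  SigmaFinite.withDensity_of_ne_top <| Eventually.of_forall fun x => by
    rw [prod_gaussDensity]; exact ENNReal.ofReal_ne_top

theorem pi_stdComplexGaussian_eq {κ : Type*} [Fintype κ] :
    (Measure.pi fun _ : κ => stdComplexGaussian)
      = (volume : Measure (κ → ℂ)).withDensity fun x => ∏ j, gaussDensity (x j) := by
  have : SigmaFinite ((volume : Measure ℂ).withDensity gaussDensity) := by
    rw [← stdComplexGaussian_eq]; infer_instance
  rw [stdComplexGaussian_eq]
  exact pi_withDensity (f := fun _ : κ => gaussDensity) (μ := fun _ => (volume : Measure ℂ))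
    fun _ => measurable_gaussDensity

theorem pi_pi_stdComplexGaussian_eq {ι κ : Type*} [Fintype ι] [Fintype κ] :
    (Measure.pi fun _ : ι => Measure.pi fun _ : κ => stdComplexGaussian)
      = (volume : Measure (ι → κ → ℂ)).withDensity fun W => ∏ i, ∏ j, gaussDensity (W i j) := by
  rw [pi_stdComplexGaussian_eq]
  exact pi_withDensity (f := fun (_ : ι) (x : κ → ℂ) => ∏ j, gaussDensity (x j))
    (μ := fun _ => (volume : Measure (κ → ℂ))) fun _ => by fun_prop

theorem continuous_normSq_det {α ι : Type*} [TopologicalSpace α] [Fintype ι] [DecidableEq ι]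
    {A : α → Matrix ι ι ℂ} (hA : Continuous A) :
    Continuous fun x => Complex.normSq (A x).det :=
  Complex.continuous_normSq.comp hA.matrix_det

section

variable {ι : Type*} [Fintype ι] [DecidableEq ι]

open Matrix
open scoped Nat

/-- The expected squared determinant under the Gaussian weight of a matrix with left eigenvector
`(v, 1)` and eigenvalue `z`. -/
theorem lintegral_gaussian_eigenvector_weight (v : ι → ℂ) (z : ℂ) :
    ∫⁻ W : ι → ι ⊕ Unit → ℂ, (∏ i, ∏ j, gaussDensity (W i j)) *
        ((∏ j, gaussDensity (z * (Sum.elim v 1 : ι ⊕ Unit → ℂ) j - (v ᵥ* of W) j)) *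
        ENNReal.ofReal (Complex.normSq (z • (1 : Matrix ι ι ℂ) - (of W).toCols₁
              + vecMulVec (fun i => W i (Sum.inr ())) v).det))
      = ENNReal.ofReal ((1 + ∑ i, Complex.normSq (v i))⁻¹ ^ (Fintype.card ι + 1)) *
        ENNReal.ofReal ((Real.pi⁻¹) ^ (Fintype.card ι + 1) * Real.exp (-Complex.normSq z) *
          ∑ k ∈ Finset.range (Fintype.card ι + 1),
            ((Fintype.card ι)! : ℝ) / k ! * Complex.normSq z ^ k) := by
  have hpi := Real.pi_pos
  obtain ⟨R, H, b, hR, hH, hRH⟩ := exists_deflation v z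
  let b' : ι → ι ⊕ Unit → ℂ := b
  set m := Fintype.card ι
  have hcard : Fintype.card (ι ⊕ Unit) = m + 1 := by simp [m]
  set T : ℝ := 1 + ∑ i, Complex.normSq (v i)
  have hT : 0 < T := by
    have := Finset.sum_nonneg fun i (_ : i ∈ Finset.univ) => Complex.normSq_nonneg (v i)
    simp only [T]; linarith
  set L := mulLeftRight R H
  -- The matrix `R` acts on $m+1$ columns with $|\det R|^2=T$, and `H` is unimodular. This is the
  -- source of the exponent $m+1$ in the weight of `v`.
  have hL : Complex.normSq L.det = T ^ (m + 1) := by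
    rw [det_mulLeftRight, map_mul, map_pow, map_pow, hR, hH, hcard, one_pow, mul_one]
  have hL0 : L.det ≠ 0 := by
    rw [← Complex.normSq_pos, hL]; positivity
  let D : (ι → ι ⊕ Unit → ℂ) → ℝ≥0∞ := fun N => ENNReal.ofReal (Complex.normSq
    (Matrix.of fun i j => (if i = j then z else 0) - N i (Sum.inl j)).det)
  let G : (ι → ι ⊕ Unit → ℂ) → ℝ≥0∞ := fun N => (∏ i, ∏ j, gaussDensity (N i j)) * D N
  have hD : Measurable D := by
    refine Measurable.ennreal_ofReal (Continuous.measurable (continuous_normSq_det ?_))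
    refine continuous_pi fun i => continuous_pi fun j => ?_
    simp only [of_apply]
    fun_prop
  have hG : Measurable G := by
    refine Measurable.mul ?_ hD
    fun_prop
  have hpoint : ∀ W : ι → ι ⊕ Unit → ℂ, (∏ i, ∏ j, gaussDensity (W i j)) *
        ((∏ j, gaussDensity (z * (Sum.elim v 1 : ι ⊕ Unit → ℂ) j - (v ᵥ* of W) j)) *
        ENNReal.ofReal (Complex.normSq (z • (1 : Matrix ι ι ℂ) - (of W).toCols₁
              + vecMulVec (fun i => W i (Sum.inr ())) v).det))
      = ENNReal.ofReal ((Real.pi⁻¹) ^ (m + 1) * Real.exp (-Complex.normSq z)) * G (L W - b') := by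
    intro W
    obtain ⟨h1, h2⟩ := hRH (of W)
    have h3 : D (L W - b') = ENNReal.ofReal (Complex.normSq (z • (1 : Matrix ι ι ℂ) - (of W).toCols₁
        + vecMulVec (fun i => W i (Sum.inr ())) v).det) := by
      rw [show (fun i => W i (Sum.inr ())) = fun i => of W i (Sum.inr ()) from rfl, ← h2]
      rfl
    rw [← h3]
    simp only [G]
    rw [← mul_assoc, ← mul_assoc]
    congr 1
    rw [prod_prod_gaussDensity, prod_prod_gaussDensity, prod_gaussDensity,
      ← ENNReal.ofReal_mul (by positivity), ← ENNReal.ofReal_mul (by positivity)]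
    congr 1
    rw [Finset.card_univ, hcard, mul_mul_mul_comm, ← Real.exp_add,
      mul_mul_mul_comm (Real.pi⁻¹ ^ (m + 1)), ← Real.exp_add, mul_comm (Real.pi⁻¹ ^ _) (Real.pi⁻¹ ^ (m + 1))]
    congr 2
    rw [← neg_add, ← neg_add, neg_inj]
    refine Eq.trans h1.symm ?_
    rw [add_comm]
    rfl
  simp_rw [hpoint]
  have hLmeas : Measurable L := (LinearMap.continuous_of_finiteDimensional L).measurable
  have : (volume : Measure (ι → ι ⊕ Unit → ℂ)).IsAddHaarMeasure := Measure.pi.isAddHaarMeasure _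
  have hcov := lintegral_eq_normSq_det_mul_lintegral_comp
    (volume : Measure (ι → ι ⊕ Unit → ℂ)) L hL0 (f := fun N => G (N - b'))
    (hG.comp (measurable_id.sub_const b'))
  have htrans : ∫⁻ N, G (N - b') = ∫⁻ N, G N :=
    lintegral_sub_right_eq_self G b'
  have hGint : ∫⁻ N, G N = ENNReal.ofReal (∑ k ∈ Finset.range (m + 1),
            ((m)! : ℝ) / k ! * Complex.normSq z ^ k) := by
    rw [← lintegral_normSq_det_sub (Sum.inl : ι → ι ⊕ Unit) Sum.inl_injective z,
      pi_pi_stdComplexGaussian_eq, lintegral_withDensity_eq_lintegral_mul _ (by fun_prop) hD]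
    rfl
  rw [htrans, hGint, hL] at hcov
  have hGL : Measurable fun W => G (L W - b') := hG.comp (hLmeas.sub_const b')
  rw [lintegral_const_mul _ hGL]
  have hfin : ∫⁻ N, G (L N - b') = ENNReal.ofReal (T⁻¹ ^ (m + 1)) *
      ENNReal.ofReal (∑ k ∈ Finset.range (m + 1), ((m)! : ℝ) / k ! * Complex.normSq z ^ k) := by
    rw [hcov, ← mul_assoc, ← ENNReal.ofReal_mul (by positivity), ← mul_pow,
      inv_mul_cancel₀ hT.ne', one_pow, ENNReal.ofReal_one, one_mul]
  rw [hfin, ENNReal.ofReal_mul (p := _ * Real.exp _) (by positivity), mul_left_comm]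

end

/-! ### The change of variables from the last row to an eigenvalue and its left eigenvector. -/

section

open Matrix

variable {ι : Type*} [Fintype ι] [DecidableEq ι]

attribute [local instance] Matrix.linftyOpNormedRing Matrix.linftyOpNormedAlgebra in
theorem hasDerivAt_dotProduct_resolvent (A : Matrix ι ι ℂ) (r c : ι → ℂ) {z : ℂ}
    (hz : (z • (1 : Matrix ι ι ℂ) - A).det ≠ 0) :
    HasDerivAt (fun z : ℂ => r ⬝ᵥ ((z • (1 : Matrix ι ι ℂ) - A)⁻¹ *ᵥ c))
      (-(r ⬝ᵥ ((z • (1 : Matrix ι ι ℂ) - A)⁻¹ *ᵥ ((z • (1 : Matrix ι ι ℂ) - A)⁻¹ *ᵥ c)))) z := by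
  have : CompleteSpace (Matrix ι ι ℂ) := FiniteDimensional.complete ℂ _
  have hres : ∀ w : ℂ, resolvent A w = (w • (1 : Matrix ι ι ℂ) - A)⁻¹ := fun w => by
    rw [resolvent, nonsing_inv_eq_ringInverse, Algebra.algebraMap_eq_smul_one]
  have hmem : z ∈ resolventSet ℂ A := by
    rw [spectrum.mem_resolventSet_iff, Algebra.algebraMap_eq_smul_one, isUnit_iff_isUnit_det]
    exact isUnit_iff_ne_zero.2 hz
  have h := spectrum.hasDerivAt_resolvent_const_left hmem
  let ℓ : Matrix ι ι ℂ →ₗ[ℂ] ℂ :=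
    { toFun := fun M => r ⬝ᵥ (M *ᵥ c)
      map_add' := fun M N => by rw [add_mulVec, dotProduct_add]
      map_smul' := fun a M => by rw [smul_mulVec, dotProduct_smul]; rfl }
  have h2 := (LinearMap.toContinuousLinearMap ℓ).hasFDerivAt.comp_hasDerivAt z h
  have e1 : (LinearMap.toContinuousLinearMap ℓ) ∘ resolvent A
      = fun z : ℂ => r ⬝ᵥ ((z • (1 : Matrix ι ι ℂ) - A)⁻¹ *ᵥ c) := by
    funext w
    simp only [Function.comp_apply, hres]
    rfl
  rw [e1, hres] at h2
  refine h2.congr_deriv ?_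
  change r ⬝ᵥ ((-((z • (1 : Matrix ι ι ℂ) - A)⁻¹ ^ 2)) *ᵥ c) = _
  rw [sq, neg_mulVec, dotProduct_neg, mulVec_mulVec]

omit [DecidableEq ι] in
theorem measurable_mulVec {α : Type*} [MeasurableSpace α] {A : α → Matrix ι ι ℂ}
    (hA : ∀ i j, Measurable fun x => A x i j) {c : α → ι → ℂ} (hc : Measurable c) :
    Measurable fun x => A x *ᵥ c x :=
  measurable_pi_lambda _ fun i => Finset.measurable_sum _ fun j _ =>
    (hA i j).mul ((measurable_pi_apply j).comp hc)

omit [DecidableEq ι] in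
theorem measurable_dotProduct {α : Type*} [MeasurableSpace α] {b c : α → ι → ℂ}
    (hb : Measurable b) (hc : Measurable c) : Measurable fun x => b x ⬝ᵥ c x :=
  Finset.measurable_sum _ fun j _ =>
    ((measurable_pi_apply j).comp hb).mul ((measurable_pi_apply j).comp hc)

theorem measurable_inv_apply {α : Type*} [TopologicalSpace α] [MeasurableSpace α]
    [OpensMeasurableSpace α] {A : α → Matrix ι ι ℂ} (hA : Continuous A) (i j : ι) :
    Measurable fun x => (A x)⁻¹ i j := by
  have : ∀ x, (A x)⁻¹ i j = ((A x).det)⁻¹ * (A x).adjugate i j := by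
    intro x
    rw [inv_def, Ring.inverse_eq_inv', Matrix.smul_apply, smul_eq_mul]
  simp_rw [this]
  exact hA.matrix_det.measurable.inv.mul (hA.matrix_adjugate.matrix_elem i j).measurable

/-- The hypothesis `hx` says that the Schur complement of $z-A$ vanishes. -/
theorem det_smul_one_sub_fromBlocks_eq_zero (A : Matrix ι ι ℂ) (r c : ι → ℂ) {z x : ℂ}
    (hz : (z • (1 : Matrix ι ι ℂ) - A).det ≠ 0)
    (hx : z - r ⬝ᵥ ((z • (1 : Matrix ι ι ℂ) - A)⁻¹ *ᵥ c) = x) :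
    (z • (1 : Matrix (ι ⊕ Unit) (ι ⊕ Unit) ℂ) - fromBlocks A (replicateCol Unit c)
      (replicateRow Unit r) (of fun _ _ => x)).det = 0 := by
  have : Invertible (z • (1 : Matrix ι ι ℂ) - A) :=
    invertibleOfIsUnitDet _ (isUnit_iff_ne_zero.2 hz)
  rw [← fromBlocks_one, fromBlocks_smul, sub_eq_add_neg, fromBlocks_neg, fromBlocks_add,
    ← sub_eq_add_neg, det_fromBlocks₁₁, invOf_eq_nonsing_inv]
  simp only [smul_zero, zero_add]
  convert mul_zero _
  rw [det_unique, Matrix.neg_mul, Matrix.neg_mul, Matrix.mul_neg, neg_neg, ← hx]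
  simp [mul_apply, dotProduct, mulVec, Finset.mul_sum, Finset.sum_mul, mul_assoc]
  rw [Finset.sum_comm]
  ring

/-- A lower bound for the expected number of eigenvalues in `B`, as the lower right entry of the
matrix varies. -/
theorem setLIntegral_gaussDensity_le_of_card_le (A : Matrix ι ι ℂ) (r c : ι → ℂ) {B : Set ℂ}
    (hB : MeasurableSet B) {N : ℂ → ℝ≥0∞}
    (hN : ∀ x, ∀ F : Finset ℂ, (∀ z ∈ F, z ∈ B ∧
      (z • (1 : Matrix (ι ⊕ Unit) (ι ⊕ Unit) ℂ) - fromBlocks A (replicateCol Unit c)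
      (replicateRow Unit r) (of fun _ _ => x)).det = 0) → (F.card : ℝ≥0∞) ≤ N x) :
    ∫⁻ z in B ∩ {z | (z • (1 : Matrix ι ι ℂ) - A).det ≠ 0},
      gaussDensity (z - r ⬝ᵥ ((z • (1 : Matrix ι ι ℂ) - A)⁻¹ *ᵥ c)) * ENNReal.ofReal
        (Complex.normSq (1 + r ⬝ᵥ ((z • (1 : Matrix ι ι ℂ) - A)⁻¹ *ᵥ
          ((z • (1 : Matrix ι ι ℂ) - A)⁻¹ *ᵥ c))))
      ≤ ∫⁻ x, gaussDensity x * N x := by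
  have hcont : Continuous fun z : ℂ => z • (1 : Matrix ι ι ℂ) - A := by fun_prop
  have hU : MeasurableSet {z : ℂ | (z • (1 : Matrix ι ι ℂ) - A).det ≠ 0} :=
    (isOpen_ne_fun hcont.matrix_det continuous_const).measurableSet
  set ζ' : ℂ → ℂ := fun z => 1 + r ⬝ᵥ ((z • (1 : Matrix ι ι ℂ) - A)⁻¹ *ᵥ
          ((z • (1 : Matrix ι ι ℂ) - A)⁻¹ *ᵥ c)) with hζ'
  have hζm : Measurable ζ' := by
    have h := measurable_inv_apply hcont
    exact (measurable_dotProduct measurable_const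
      (measurable_mulVec h (measurable_mulVec h measurable_const))).const_add 1
  have hV : MeasurableSet {z | ζ' z ≠ 0} := hζm (measurableSet_singleton 0).compl
  rw [← lintegral_indicator (hB.inter hU)]
  -- Critical points of $z\mapsto x$ can be discarded, because the Jacobian factor in the integrand
  -- is zero there.
  have hs : MeasurableSet ((B ∩ {z : ℂ | (z • (1 : Matrix ι ι ℂ) - A).det ≠ 0}) ∩ {z | ζ' z ≠ 0}) :=
    (hB.inter hU).inter hV
  refine le_trans (le_of_eq ?_) (lintegral_comp_mul_normSq_deriv_le (f' := ζ')
    (f := fun z => z - r ⬝ᵥ ((z • (1 : Matrix ι ι ℂ) - A)⁻¹ *ᵥ c)) hs ?_ (fun z hz => hz.2)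
    measurable_gaussDensity ?_)
  · rw [← lintegral_indicator hs]
    refine lintegral_congr fun z => ?_
    by_cases h1 : z ∈ B ∩ {z : ℂ | (z • (1 : Matrix ι ι ℂ) - A).det ≠ 0}
    · by_cases h2 : ζ' z = 0
      · rw [Set.indicator_of_mem h1, Set.indicator_of_notMem (fun h => h.2 h2)]
        simp only [hζ'] at h2
        rw [h2]
        simp
      · rw [Set.indicator_of_mem h1, Set.indicator_of_mem (show z ∈ _ ∩ {z | ζ' z ≠ 0} from ⟨h1, h2⟩)]
    · rw [Set.indicator_of_notMem h1, Set.indicator_of_notMem (fun h => h1 h.1)]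
  · intro z hz
    have := (hasDerivAt_id z).sub (hasDerivAt_dotProduct_resolvent A r c hz.1.2)
    rw [sub_neg_eq_add] at this
    exact this
  · intro x F hF
    exact hN x F fun z hz => ⟨(hF z hz).1.1.1,
      det_smul_one_sub_fromBlocks_eq_zero A r c (hF z hz).1.1.2 (hF z hz).2⟩

/-- The joint weight of the row `r` and the corner entry for which `z` is an eigenvalue, where
`M = z - A`. -/
noncomputable def rowWeight (z : ℂ) (M : Matrix ι ι ℂ) (c r : ι → ℂ) : ℝ≥0∞ :=
  (∏ i, gaussDensity (r i)) * (gaussDensity (z - r ⬝ᵥ (M⁻¹ *ᵥ c)) *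
    ENNReal.ofReal (Complex.normSq (1 + r ⬝ᵥ (M⁻¹ *ᵥ (M⁻¹ *ᵥ c)))))

theorem measurable_rowWeight {M : ℂ → Matrix ι ι ℂ} (hM : Continuous M) (c : ι → ℂ) :
    Measurable fun p : ℂ × (ι → ℂ) => rowWeight p.1 (M p.1) c p.2 := by
  have h1 := measurable_inv_apply hM
  have h2 : Measurable Complex.normSq := Complex.continuous_normSq.measurable
  have h3 : Measurable fun p : ℂ × (ι → ℂ) => (M p.1)⁻¹ *ᵥ c :=
    (measurable_mulVec h1 measurable_const).comp measurable_fst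
  have h4 : Measurable fun p : ℂ × (ι → ℂ) => (M p.1)⁻¹ *ᵥ ((M p.1)⁻¹ *ᵥ c) :=
    (measurable_mulVec h1 (measurable_mulVec h1 measurable_const)).comp measurable_fst
  have h5 := measurable_dotProduct (measurable_snd (α := ℂ)) h3
  have h6 := measurable_dotProduct (measurable_snd (α := ℂ)) h4
  exact Measurable.mul (by fun_prop) ((measurable_gaussDensity.comp (measurable_fst.sub h5)).mul
    (h2.comp (h6.const_add 1)).ennreal_ofReal)

theorem measurable_rowWeight_right (z : ℂ) (M : Matrix ι ι ℂ) (c : ι → ℂ) :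
    Measurable (rowWeight z M c) := by
  have h2 : Measurable Complex.normSq := Complex.continuous_normSq.measurable
  unfold rowWeight
  generalize M⁻¹ *ᵥ (M⁻¹ *ᵥ c) = a
  generalize M⁻¹ *ᵥ c = b
  have ha : Measurable fun r : ι → ℂ => r ⬝ᵥ a := measurable_dotProduct measurable_id measurable_const
  have hb : Measurable fun r : ι → ℂ => r ⬝ᵥ b := measurable_dotProduct measurable_id measurable_const
  fun_prop

theorem lintegral_eq_normSq_det_mul_lintegral_vecMul {M : Matrix ι ι ℂ} (hM : M.det ≠ 0)
    {f : (ι → ℂ) → ℝ≥0∞} (hf : Measurable f) :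
    ∫⁻ r, f r = ENNReal.ofReal (Complex.normSq M.det) * ∫⁻ v, f (v ᵥ* M) := by
  have hdet : (Matrix.toLin' Mᵀ).det = M.det := by rw [LinearMap.det_toLin', det_transpose]
  rw [lintegral_eq_normSq_det_mul_lintegral_comp (volume : Measure (ι → ℂ))
    (Matrix.toLin' Mᵀ) (by rw [hdet]; exact hM) hf, hdet]
  simp_rw [toLin'_apply, mulVec_transpose]

/-- The substitution is $r=vM$, with Jacobian $|\det M|^2$. The matrix determinant lemma merges it
with the Jacobian $|1+rM^{-2}c|^2=|1+vM^{-1}c|^2$ of the corner entry, and no inverse of `M` is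
left. -/
theorem lintegral_rowWeight (z : ℂ) {M : Matrix ι ι ℂ} (hM : M.det ≠ 0) (c : ι → ℂ) :
    ∫⁻ r : ι → ℂ, rowWeight z M c r = ∫⁻ v : ι → ℂ,
      ((∏ i, gaussDensity ((v ᵥ* M) i)) * gaussDensity (z - v ⬝ᵥ c)) *
        ENNReal.ofReal (Complex.normSq (M + vecMulVec c v).det) := by
  have hunit : IsUnit M.det := isUnit_iff_ne_zero.2 hM
  have hw := measurable_rowWeight_right z M c
  have hvm : Measurable fun v : ι → ℂ => v ᵥ* M :=
    (continuous_id.matrix_vecMul continuous_const).measurable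
  have hw' : Measurable fun v => rowWeight z M c (v ᵥ* M) := hw.comp hvm
  rw [lintegral_eq_normSq_det_mul_lintegral_vecMul hM hw,
    ← lintegral_const_mul _ hw']
  refine lintegral_congr fun v => ?_
  have hd1 : (v ᵥ* M) ⬝ᵥ (M⁻¹ *ᵥ c) = v ⬝ᵥ c := by
    rw [← dotProduct_mulVec, mulVec_mulVec, mul_nonsing_inv _ hunit, one_mulVec]
  have hd2 : (v ᵥ* M) ⬝ᵥ (M⁻¹ *ᵥ (M⁻¹ *ᵥ c)) = v ⬝ᵥ (M⁻¹ *ᵥ c) := by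
    rw [← dotProduct_mulVec, mulVec_mulVec, mul_nonsing_inv _ hunit, one_mulVec]
  have hd3 : (M + vecMulVec c v).det = M.det * (1 + v ⬝ᵥ (M⁻¹ *ᵥ c)) := by
    rw [vecMulVec_eq Unit, det_add_replicateCol_mul_replicateRow hunit]
    congr 2
    rw [det_unique]
    simp only [dotProduct, mulVec, Matrix.add_apply, one_apply_eq, Matrix.mul_apply, replicateRow_apply,
      replicateCol_apply, Finset.mul_sum, Finset.sum_mul, mul_assoc]
    rw [Finset.sum_comm]
  rw [rowWeight, hd1, hd2, hd3, Complex.normSq_mul,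
    ENNReal.ofReal_mul (Complex.normSq_nonneg _)]
  ring

/-- With the upper rows `W` frozen, the area formula in the corner entry is applied for each `r`.
Tonelli and the substitution $r=v(z-A)$ then express the bound through the eigenvector. -/
theorem lintegral_gaussian_row_ge (W : ι → ι ⊕ Unit → ℂ) {B : Set ℂ} (hB : MeasurableSet B)
    {N : (ι → ℂ) → ℂ → ℝ≥0∞}
    (hN : ∀ r x, ∀ F : Finset ℂ, (∀ z ∈ F, z ∈ B ∧
      (z • (1 : Matrix (ι ⊕ Unit) (ι ⊕ Unit) ℂ) - fromBlocks (of W).toCols₁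
        (replicateCol Unit fun i => W i (Sum.inr ()))
      (replicateRow Unit r) (of fun _ _ => x)).det = 0) → (F.card : ℝ≥0∞) ≤ N r x) :
    ∫⁻ z in B, ∫⁻ v : ι → ℂ,
        (∏ j, gaussDensity (z * (Sum.elim v 1 : ι ⊕ Unit → ℂ) j - (v ᵥ* of W) j)) *
        ENNReal.ofReal (Complex.normSq (z • (1 : Matrix ι ι ℂ) - (of W).toCols₁
              + vecMulVec (fun i => W i (Sum.inr ())) v).det)
      ≤ ∫⁻ r : ι → ℂ, (∏ i, gaussDensity (r i)) * ∫⁻ x, gaussDensity x * N r x := by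
  set A := (of W).toCols₁
  set c : ι → ℂ := fun i => W i (Sum.inr ())
  set M : ℂ → Matrix ι ι ℂ := fun z => z • (1 : Matrix ι ι ℂ) - A with hM
  have hcont : Continuous M := by fun_prop
  set U : Set ℂ := {z | (M z).det ≠ 0}
  have hUm : MeasurableSet U := (isOpen_ne_fun hcont.matrix_det continuous_const).measurableSet
  -- The excluded points are the finitely many eigenvalues of `A`.
  have hUnull : volume Uᶜ = 0 := by
    have hfin : Uᶜ.Finite := by
      refine (A.charpoly.roots.toFinset.finite_toSet).subset fun z hz => ?_
      have hz' : (M z).det = 0 := by simpa [U] using hz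
      simp only [Finset.mem_coe, Multiset.mem_toFinset]
      rw [Polynomial.mem_roots A.charpoly_monic.ne_zero, Polynomial.IsRoot, eval_charpoly, ← hz',
        scalar_apply, ← smul_one_eq_diagonal]
    exact hfin.measure_zero _
  have hg := measurable_rowWeight hcont c
  calc _ = ∫⁻ z in B ∩ U, ∫⁻ v : ι → ℂ,
          (∏ j, gaussDensity (z * (Sum.elim v 1 : ι ⊕ Unit → ℂ) j - (v ᵥ* of W) j)) *
          ENNReal.ofReal (Complex.normSq (M z + vecMulVec c v).det) := by
        refine setLIntegral_congr ?_
        refine (inter_ae_eq_left_of_ae_eq_univ ?_).symm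
        exact ae_eq_univ.2 hUnull
    _ = ∫⁻ z in B ∩ U, ∫⁻ r : ι → ℂ, rowWeight z (M z) c r := by
        refine setLIntegral_congr_fun (hB.inter hUm) fun z hz => ?_
        rw [lintegral_rowWeight z hz.2 c]
        refine lintegral_congr fun v => ?_
        have hp1 : ∀ i : ι, z * (Sum.elim v 1 : ι ⊕ Unit → ℂ) (Sum.inl i)
            - (v ᵥ* of W) (Sum.inl i) = (v ᵥ* M z) i := by
          intro i
          rw [hM, vecMul_sub, vecMul_smul, vecMul_one]
          rfl
        have hp2 : ∀ i : Unit, z * (Sum.elim v 1 : ι ⊕ Unit → ℂ) (Sum.inr i)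
            - (v ᵥ* of W) (Sum.inr i) = z - v ⬝ᵥ c := by
          intro i
          rw [Sum.elim_inr, Pi.one_apply, mul_one]
          rfl
        rw [Fintype.prod_sum_type]
        simp only [hp1, hp2, Finset.univ_unique, Finset.prod_singleton]
    _ = ∫⁻ r : ι → ℂ, ∫⁻ z in B ∩ U, rowWeight z (M z) c r :=
        lintegral_lintegral_swap hg.aemeasurable
    _ ≤ ∫⁻ r : ι → ℂ, (∏ i, gaussDensity (r i)) * ∫⁻ x, gaussDensity x * N r x := by
        refine lintegral_mono fun r => ?_
        have hne : ∏ i, gaussDensity (r i) ≠ ∞ := by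
          rw [prod_gaussDensity]; exact ENNReal.ofReal_ne_top
        simp only [rowWeight]
        rw [lintegral_const_mul' _ _ hne]
        refine mul_le_mul_right (α := ℝ≥0∞) ?_ _
        exact setLIntegral_gaussDensity_le_of_card_le A r c hB (hN r)

end

/-! ### Counting eigenvalues and measurability of the spectral measure. -/

section Counting

open Polynomial

theorem exists_map_univ_eq {α : Type*} {n : ℕ} {s : Multiset α} (hs : s.card = n) :
    ∃ w : Fin n → α, (Finset.univ : Finset (Fin n)).val.map w = s := by
  obtain ⟨l, rfl⟩ := Quot.exists_rep s
  change l.length = n at hs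
  subst hs
  refine ⟨l.get, ?_⟩
  change Multiset.map l.get (Finset.univ : Finset (Fin l.length)).val = (l : Multiset α)
  rw [Fin.univ_val_map, List.ofFn_get]

open Classical in
theorem sum_map_dirac_apply (s : Multiset ℂ) {B : Set ℂ} (hB : MeasurableSet B) :
    (s.map fun z => Measure.dirac z).sum B = (s.countP (· ∈ B) : ℝ≥0∞) := by
  induction s using Multiset.induction with
  | empty => simp
  | cons a s ih =>
    rw [Multiset.map_cons, Multiset.sum_cons, Measure.add_apply, ih, Multiset.countP_cons,
      Measure.dirac_apply' _ hB, Set.indicator_apply]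
    split_ifs <;> simp [add_comm]

variable {n : ℕ}

open Classical in
theorem spectralMeasure_apply (A : Matrix (Fin n) (Fin n) ℂ) {B : Set ℂ} (hB : MeasurableSet B) :
    spectralMeasure A B = (n : ℝ≥0∞)⁻¹ * (A.charpoly.roots.countP (· ∈ B) : ℝ≥0∞) := by
  rw [spectralMeasure, Measure.smul_apply, sum_map_dirac_apply _ hB, smul_eq_mul]

theorem card_roots_charpoly (A : Matrix (Fin n) (Fin n) ℂ) : A.charpoly.roots.card = n := by
  rw [splits_iff_card_roots.1 (IsAlgClosed.splits A.charpoly), Matrix.charpoly_natDegree_eq_dim,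
    Fintype.card_fin]

theorem spectralMeasure_univ_le (A : Matrix (Fin n) (Fin n) ℂ) : spectralMeasure A Set.univ ≤ 1 := by
  classical
  rw [spectralMeasure_apply A MeasurableSet.univ]
  simp only [Set.mem_univ, Multiset.countP_True, card_roots_charpoly]
  exact ENNReal.inv_mul_le_one _

instance (A : Matrix (Fin n) (Fin n) ℂ) : IsFiniteMeasure (spectralMeasure A) :=
  ⟨(spectralMeasure_univ_le A).trans_lt ENNReal.one_lt_top⟩

open Classical in
/-- Having at least `k` eigenvalues in the closed set `F` is a condition on the values of the
characteristic polynomial, given by a σ-compact set. -/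
theorem le_countP_roots_charpoly_iff (A : Matrix (Fin n) (Fin n) ℂ) (F : Set ℂ) (k : ℕ) :
    k ≤ A.charpoly.roots.countP (· ∈ F) ↔
      (fun j : ℕ => (Matrix.scalar (Fin n) (j : ℂ) - A).det) ∈
        (fun (w : Fin n → ℂ) (j : ℕ) => ∏ i, ((j : ℂ) - w i)) ''
          ⋃ I : {I : Finset (Fin n) // k ≤ I.card}, {w | ∀ i ∈ I.1, w i ∈ F} := by
  have hcount : ∀ w : Fin n → ℂ, ((Finset.univ : Finset (Fin n)).val.map w).countP (· ∈ F)
      = (Finset.univ.filter fun i => w i ∈ F).card := by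
    intro w
    rw [Multiset.countP_map]; rfl
  have hmon := A.charpoly_monic
  constructor
  · intro hk
    obtain ⟨w, hw⟩ := exists_map_univ_eq (card_roots_charpoly A)
    refine ⟨w, Set.mem_iUnion.2 ⟨⟨Finset.univ.filter fun i => w i ∈ F, ?_⟩, fun i hi =>
      (Finset.mem_filter.1 hi).2⟩, ?_⟩
    · rwa [← hcount, hw]
    · funext j
      rw [← Matrix.eval_charpoly, (IsAlgClosed.splits A.charpoly).eq_prod_roots_of_monic hmon, ← hw,
        Multiset.map_map]
      change _ = eval (j : ℂ) (∏ i, (X - C (w i)))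
      rw [eval_prod]
      simp
  · rintro ⟨w, hw, hj⟩
    obtain ⟨⟨I, hI⟩, hwI⟩ := Set.mem_iUnion.1 hw
    have hp : A.charpoly = ∏ i, (X - C (w i)) := by
      -- A polynomial is determined by its values at the natural numbers, so a countable family of
      -- determinants encodes the whole spectrum.
      refine eq_of_infinite_eval_eq _ _ (Set.infinite_of_injective_forall_mem
        (f := fun j : ℕ => (j : ℂ)) Nat.cast_injective fun j => ?_)
      have := congrFun hj j
      simp only [Set.mem_ofPred_eq, Matrix.eval_charpoly, eval_prod, eval_sub, eval_X, eval_C]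
      exact this.symm
    have hr : A.charpoly.roots = (Finset.univ : Finset (Fin n)).val.map w := by
      rw [hp]; exact roots_multiset_prod_X_sub_C ((Finset.univ : Finset (Fin n)).val.map w) ▸ by
        rw [Multiset.map_map]; rfl
    rw [hr, hcount]
    exact hI.trans (Finset.card_le_card fun i hi => Finset.mem_filter.2 ⟨Finset.mem_univ _, hwI i hi⟩)

/-- For a closed set, the event of having at least `k` eigenvalues in it is the preimage of a
σ-compact set under a continuous map. Closed sets form a π-system generating the Borel sets, so no
measurable choice of eigenvalues is needed. -/
theorem measurable_spectralMeasure {α : Type*} [TopologicalSpace α] [MeasurableSpace α]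
    [OpensMeasurableSpace α] {A : α → Matrix (Fin n) (Fin n) ℂ} (hA : Continuous A) :
    Measurable fun a => spectralMeasure (A a) := by
  classical
  have key : ∀ F : Set ℂ, IsClosed F → Measurable fun a => spectralMeasure (A a) F := by
    intro F hF
    simp_rw [spectralMeasure_apply _ hF.measurableSet]
    refine Measurable.const_mul ?_ _
    have hN : Measurable fun a => (A a).charpoly.roots.countP (· ∈ F) := by
      refine measurable_of_Ici fun k => ?_
      have hcl : IsClosed (⋃ I : {I : Finset (Fin n) // k ≤ I.card},
          {w : Fin n → ℂ | ∀ i ∈ I.1, w i ∈ F}) := by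
        refine isClosed_iUnion_of_finite fun I => ?_
        simp only [Set.ofPred_forall]
        exact isClosed_biInter fun i _ => hF.preimage (continuous_apply i)
      have hσ : IsSigmaCompact ((fun (w : Fin n → ℂ) (j : ℕ) => ∏ i, ((j : ℂ) - w i)) ''
          ⋃ I : {I : Finset (Fin n) // k ≤ I.card}, {w | ∀ i ∈ I.1, w i ∈ F}) :=
        (isSigmaCompact_univ.of_isClosed_subset hcl (Set.subset_univ _)).image (by fun_prop)
      have hmeas : MeasurableSet ((fun (w : Fin n → ℂ) (j : ℕ) => ∏ i, ((j : ℂ) - w i)) ''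
          ⋃ I : {I : Finset (Fin n) // k ≤ I.card}, {w | ∀ i ∈ I.1, w i ∈ F}) := by
        obtain ⟨K, hK, hKU⟩ := hσ
        rw [← hKU]
        exact MeasurableSet.iUnion fun i => (hK i).measurableSet
      have hcont : Continuous fun a => (fun j : ℕ => (Matrix.scalar (Fin n) (j : ℂ) - A a).det) :=
        continuous_pi fun j => (continuous_const.sub hA).matrix_det
      convert hcont.measurable hmeas using 1
      ext a
      exact le_countP_roots_charpoly_iff (A a) F k
    exact (measurable_from_top (f := fun k : ℕ => (k : ℝ≥0∞))).comp hN
  exact Measurable.measure_of_isPiSystem (BorelSpace.measurable_eq.trans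
    borel_eq_generateFrom_isClosed) isPiSystem_isClosed (fun s hs => key s hs)
    (key _ isClosed_univ)

/-- A set of eigenvalues of `A` whose rescalings lie in `B` bounds the empirical spectral
distribution of `B` from below. -/
theorem card_le_empiricalSpectralDistribution (hn : n ≠ 0) (A : Matrix (Fin n) (Fin n) ℂ)
    {B : Set ℂ} (hB : MeasurableSet B) (F : Finset ℂ)
    (hF : ∀ z ∈ F, ((Real.sqrt n : ℝ) : ℂ)⁻¹ * z ∈ B ∧
      (z • (1 : Matrix (Fin n) (Fin n) ℂ) - A).det = 0) :
    (F.card : ℝ≥0∞) ≤ n * empiricalSpectralDistribution A B := by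
  classical
  set a : ℂ := ((Real.sqrt n : ℝ) : ℂ)⁻¹ with ha
  have ha0 : a ≠ 0 := by
    have : Real.sqrt n ≠ 0 := (Real.sqrt_pos.2 (by positivity)).ne'
    exact inv_ne_zero (by exact_mod_cast this)
  rw [empiricalSpectralDistribution, spectralMeasure_apply _ hB, ← mul_assoc,
    ENNReal.mul_inv_cancel (by exact_mod_cast hn) (ENNReal.natCast_ne_top n), one_mul, Nat.cast_le,
    Multiset.countP_eq_card_filter, ← Finset.card_image_of_injective F (mul_right_injective₀ ha0)]
  -- The finset holds distinct eigenvalues and the multiset counts multiplicities, so only an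
  -- inequality is available, and it goes the right way.
  refine Multiset.card_le_card ((Multiset.le_iff_subset (F.image _).nodup).2 fun y hy => ?_)
  obtain ⟨z, hz, rfl⟩ := Finset.mem_image.1 (Finset.mem_def.2 hy)
  refine Multiset.mem_filter.2 ⟨?_, (hF z hz).1⟩
  rw [mem_roots (Matrix.charpoly_monic _).ne_zero, IsRoot, Matrix.eval_charpoly,
    Matrix.scalar_apply, ← Matrix.smul_one_eq_diagonal, ← smul_smul, ← smul_sub, Matrix.det_smul,
    (hF z hz).2, mul_zero]

end Counting

/-! ### The lower bound for the mean number of eigenvalues. -/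

section Combine

open Matrix
open scoped Nat

theorem lintegral_lintegral_lintegral_const_mul {α β γ : Type*} [MeasurableSpace α]
    [MeasurableSpace β] [MeasurableSpace γ] (μ : Measure α) (ν : Measure β) (ρ : Measure γ)
    [SFinite μ] [SFinite ν] [SFinite ρ] {w : α → ℝ≥0∞} (hw : Measurable w) (hwtop : ∀ a, w a ≠ ∞)
    {Q : α → β → γ → ℝ≥0∞} (hQ : Measurable fun p : α × β × γ => Q p.1 p.2.1 p.2.2) :
    ∫⁻ b, ∫⁻ c, ∫⁻ a, w a * Q a b c ∂μ ∂ρ ∂ν = ∫⁻ a, w a * ∫⁻ b, ∫⁻ c, Q a b c ∂ρ ∂ν ∂μ := by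
  calc ∫⁻ b, ∫⁻ c, ∫⁻ a, w a * Q a b c ∂μ ∂ρ ∂ν
      = ∫⁻ b, ∫⁻ a, ∫⁻ c, w a * Q a b c ∂ρ ∂μ ∂ν := by
        refine lintegral_congr fun b => lintegral_lintegral_swap ?_
        have : Measurable fun p : γ × α => Q p.2 b p.1 :=
          hQ.comp (measurable_snd.prodMk (measurable_const.prodMk measurable_fst))
        exact ((hw.comp measurable_snd).mul this).aemeasurable
    _ = ∫⁻ a, ∫⁻ b, ∫⁻ c, w a * Q a b c ∂ρ ∂ν ∂μ := by
        refine lintegral_lintegral_swap ?_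
        have : Measurable fun q : (β × α) × γ => w q.1.2 * Q q.1.2 q.1.1 q.2 :=
          (hw.comp (measurable_snd.comp measurable_fst)).mul (hQ.comp
            ((measurable_snd.comp measurable_fst).prodMk
              ((measurable_fst.comp measurable_fst).prodMk measurable_snd)))
        exact this.lintegral_prod_right'.aemeasurable
    _ = ∫⁻ a, w a * ∫⁻ b, ∫⁻ c, Q a b c ∂ρ ∂ν ∂μ := by
        refine lintegral_congr fun a => ?_
        rw [← lintegral_const_mul' _ _ (hwtop a)]
        exact lintegral_congr fun b => lintegral_const_mul' _ _ (hwtop a)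

variable {ι : Type*} [Fintype ι] [DecidableEq ι]

/-- The mean density of eigenvalues of an unscaled complex Ginibre matrix of size `m + 1`. -/
noncomputable def ginibreDensity (m : ℕ) (z : ℂ) : ℝ :=
  Real.pi⁻¹ * Real.exp (-Complex.normSq z) *
    ∑ k ∈ Finset.range (m + 1), Complex.normSq z ^ k / (k ! : ℝ)

/-- The mean number of eigenvalues in `B` of a Gaussian block matrix is at least the integral of
the density `ginibreDensity`. -/
theorem lintegral_ginibreDensity_le {B : Set ℂ} (hB : MeasurableSet B)
    {N : (ι → ι ⊕ Unit → ℂ) → (ι → ℂ) → ℂ → ℝ≥0∞}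
    (hN : ∀ W r x, ∀ F : Finset ℂ, (∀ z ∈ F, z ∈ B ∧
      (z • (1 : Matrix (ι ⊕ Unit) (ι ⊕ Unit) ℂ) - fromBlocks (of W).toCols₁
        (replicateCol Unit fun i => W i (Sum.inr ()))
      (replicateRow Unit r) (of fun _ _ => x)).det = 0) → (F.card : ℝ≥0∞) ≤ N W r x) :
    ∫⁻ z in B, ENNReal.ofReal (ginibreDensity (Fintype.card ι) z)
      ≤ ∫⁻ W, ∫⁻ r, ∫⁻ x, N W r x ∂stdComplexGaussian
        ∂(Measure.pi fun _ : ι => stdComplexGaussian)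
        ∂(Measure.pi fun _ : ι => Measure.pi fun _ : ι ⊕ Unit => stdComplexGaussian) := by
  set m := Fintype.card ι
  let Q : (ι → ι ⊕ Unit → ℂ) → ℂ → (ι → ℂ) → ℝ≥0∞ := fun W z v =>
    (∏ j, gaussDensity (z * (Sum.elim v 1 : ι ⊕ Unit → ℂ) j - (v ᵥ* of W) j)) *
        ENNReal.ofReal (Complex.normSq (z • (1 : Matrix ι ι ℂ) - (of W).toCols₁
              + vecMulVec (fun i => W i (Sum.inr ())) v).det)
  let w : (ι → ι ⊕ Unit → ℂ) → ℝ≥0∞ := fun W => ∏ i, ∏ j, gaussDensity (W i j)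
  have hw : Measurable w := by fun_prop
  have hwtop : ∀ W, w W ≠ ∞ := fun W => by
    simp only [w]; rw [prod_prod_gaussDensity]; exact ENNReal.ofReal_ne_top
  have hQ : Measurable fun p : (ι → ι ⊕ Unit → ℂ) × ℂ × (ι → ℂ) => Q p.1 p.2.1 p.2.2 := by
    refine Measurable.mul ?_ (Measurable.ennreal_ofReal (Continuous.measurable
      (continuous_normSq_det ?_)))
    · refine Finset.measurable_prod _ fun j _ => measurable_gaussDensity.comp ?_
      refine Continuous.measurable ?_
      have : Continuous fun p : (ι → ι ⊕ Unit → ℂ) × ℂ × (ι → ℂ) =>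
          (Sum.elim p.2.2 1 : ι ⊕ Unit → ℂ) j := by
        cases j <;> simp only [Sum.elim_inl, Sum.elim_inr] <;> fun_prop
      simp only [vecMul, dotProduct, of_apply]
      fun_prop
    · refine continuous_pi fun i => continuous_pi fun j => ?_
      simp only [Matrix.add_apply, Matrix.sub_apply, Matrix.smul_apply, vecMulVec_apply,
        toCols₁_apply, of_apply]
      fun_prop
  have h1 : ∀ W, ∫⁻ z in B, ∫⁻ v, Q W z v ≤ ∫⁻ r, ∫⁻ x, N W r x ∂stdComplexGaussian
        ∂(Measure.pi fun _ : ι => stdComplexGaussian) := by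
    intro W
    refine (lintegral_gaussian_row_ge W hB (hN W)).trans (le_of_eq ?_)
    -- `N` is an arbitrary function, not assumed measurable. The change to Lebesgue measure is still
    -- valid because the Gaussian density is measurable and finite.
    rw [pi_stdComplexGaussian_eq, lintegral_withDensity_eq_lintegral_mul_non_measurable _
      (by fun_prop)]
    · refine lintegral_congr fun r => ?_
      rw [Pi.mul_apply, stdComplexGaussian_eq,
        lintegral_withDensity_eq_lintegral_mul_non_measurable _ measurable_gaussDensity]
      · rfl
      · exact Eventually.of_forall fun _ => ENNReal.ofReal_lt_top
    · refine Eventually.of_forall fun _ => ?_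
      rw [prod_gaussDensity]; exact ENNReal.ofReal_lt_top
  calc ∫⁻ z in B, ENNReal.ofReal (ginibreDensity m z)
      = ∫⁻ z in B, ∫⁻ v : ι → ℂ, ∫⁻ W, w W * Q W z v := by
        refine lintegral_congr fun z => ?_
        rw [lintegral_congr fun v => lintegral_gaussian_eigenvector_weight v z,
          lintegral_mul_const', lintegral_inv_one_add_sum_normSq_pow,
          ← ENNReal.ofReal_mul (by positivity)]
        · congr 1
          -- The factor $\pi^m/m!$ from the integral over `v` cancels the $m!$ of the determinant
          -- moment and all but one power of $\pi^{-1}$.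
          rw [ginibreDensity, Finset.mul_sum, Finset.mul_sum, Finset.mul_sum]
          refine Finset.sum_congr rfl fun k _ => ?_
          have := Real.pi_pos
          field_simp
          rw [one_div, inv_pow, pow_succ]
          field_simp
        · exact ENNReal.ofReal_ne_top
    _ = ∫⁻ W, w W * ∫⁻ z in B, ∫⁻ v : ι → ℂ, Q W z v :=
        lintegral_lintegral_lintegral_const_mul _ _ _ hw hwtop hQ
    _ ≤ ∫⁻ W, w W * ∫⁻ r, ∫⁻ x, N W r x ∂stdComplexGaussian
        ∂(Measure.pi fun _ : ι => stdComplexGaussian) :=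
        lintegral_mono fun W => mul_le_mul_right (h1 W) _
    _ = _ := by
        rw [pi_pi_stdComplexGaussian_eq, lintegral_withDensity_eq_lintegral_mul_non_measurable _ hw]
        · rfl
        · exact Eventually.of_forall fun W => (hwtop W).lt_top

/-- The entries of the block matrix with upper rows `W` and last row `(r, x)`. -/
def blockEntries (p : (ι → ι ⊕ Unit → ℂ) × (ι → ℂ) × ℂ) : (ι ⊕ Unit) × (ι ⊕ Unit) → ℂ
  | (Sum.inl i, j) => p.1 i j
  | (Sum.inr _, Sum.inl i) => p.2.1 i
  | (Sum.inr _, Sum.inr _) => p.2.2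

omit [Fintype ι] [DecidableEq ι] in
theorem measurable_blockEntries : Measurable (blockEntries (ι := ι)) := by
  refine measurable_pi_lambda _ fun q => ?_
  rcases q with ⟨_ | _, _ | _⟩ <;> simp only [blockEntries] <;> fun_prop

omit [DecidableEq ι] in
theorem map_blockEntries :
    ((Measure.pi fun _ : ι => Measure.pi fun _ : ι ⊕ Unit => stdComplexGaussian).prod
      ((Measure.pi fun _ : ι => stdComplexGaussian).prod stdComplexGaussian)).map blockEntries
      = Measure.pi fun _ : (ι ⊕ Unit) × (ι ⊕ Unit) => stdComplexGaussian := by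
  symm
  refine Measure.pi_eq fun s hs => ?_
  rw [Measure.map_apply measurable_blockEntries (MeasurableSet.univ_pi hs)]
  have : blockEntries ⁻¹' (Set.univ.pi s)
      = (Set.univ.pi fun i : ι => Set.univ.pi fun j : ι ⊕ Unit => s (Sum.inl i, j)) ×ˢ
        ((Set.univ.pi fun i : ι => s (Sum.inr (), Sum.inl i)) ×ˢ s (Sum.inr (), Sum.inr ())) := by
    ext p
    simp only [Set.mem_preimage, Set.mem_pi, Set.mem_univ, true_imp_iff, Set.mem_prod]
    constructor
    · exact fun h => ⟨fun i j => h (Sum.inl i, j), fun i => h (Sum.inr (), Sum.inl i),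
        h (Sum.inr (), Sum.inr ())⟩
    · rintro ⟨h1, h2, h3⟩ ⟨_ | _, _ | _⟩
      · exact h1 _ _
      · exact h1 _ _
      · exact h2 _
      · exact h3
  rw [this, Measure.prod_prod, Measure.prod_prod, Measure.pi_pi, Measure.pi_pi,
    Fintype.prod_prod_type, Fintype.prod_sum_type]
  simp only [Measure.pi_pi, Finset.univ_unique, Finset.prod_singleton, Fintype.prod_sum_type]

end Combine

/-! ### The radial profile of the density and its primitive. -/

section Radial

open scoped Nat Topology

/-- `e^{-t} ∑_{k<n} t^k / k!`, the probability that a Poisson variable of mean `t` is below `n`. -/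
noncomputable def poissonCdf (n : ℕ) (t : ℝ) : ℝ :=
  Real.exp (-t) * ∑ k ∈ Finset.range n, t ^ k / (k ! : ℝ)

/-- An antiderivative of `poissonCdf n` vanishing at `0`. -/
noncomputable def poissonCdfPrim (n : ℕ) (t : ℝ) : ℝ :=
  n + (t - n) * poissonCdf n t - n * (Real.exp (-t) * (t ^ n / (n ! : ℝ)))

theorem poissonCdf_nonneg (n : ℕ) {t : ℝ} (ht : 0 ≤ t) : 0 ≤ poissonCdf n t := by
  unfold poissonCdf; positivity

theorem poissonCdf_le_one (n : ℕ) {t : ℝ} (ht : 0 ≤ t) : poissonCdf n t ≤ 1 := by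
  calc poissonCdf n t ≤ Real.exp (-t) * Real.exp t := by
        unfold poissonCdf
        gcongr
        exact Real.sum_le_exp_of_nonneg ht n
    _ = 1 := by rw [← Real.exp_add]; simp

theorem hasDerivAt_exp_neg (t : ℝ) : HasDerivAt (fun t => Real.exp (-t)) (-Real.exp (-t)) t := by
  simpa using (hasDerivAt_neg t).exp

theorem hasDerivAt_exp_neg_mul_pow_div_factorial (n : ℕ) (t : ℝ) :
    HasDerivAt (fun t => Real.exp (-t) * (t ^ (n + 1) / ((n + 1)! : ℝ)))
      (Real.exp (-t) * (t ^ n / (n ! : ℝ)) - Real.exp (-t) * (t ^ (n + 1) / ((n + 1)! : ℝ))) t := by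
  have h := (hasDerivAt_exp_neg t).mul ((hasDerivAt_pow (n + 1) t).div_const ((n + 1)! : ℝ))
  refine h.congr_deriv ?_
  rw [Nat.factorial_succ]
  push_cast
  have : (n ! : ℝ) ≠ 0 := by positivity
  have : (n + 1 : ℝ) ≠ 0 := by positivity
  field_simp
  ring

theorem hasDerivAt_poissonCdf (n : ℕ) (t : ℝ) :
    HasDerivAt (poissonCdf (n + 1)) (-(Real.exp (-t) * (t ^ n / (n ! : ℝ)))) t := by
  induction n with
  | zero =>
    have : poissonCdf (0 + 1) = fun t => Real.exp (-t) := by funext t; simp [poissonCdf]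
    rw [this]
    simpa using hasDerivAt_exp_neg t
  | succ n ih =>
    have : poissonCdf (n + 1 + 1)
        = fun t => poissonCdf (n + 1) t + Real.exp (-t) * (t ^ (n + 1) / ((n + 1)! : ℝ)) := by
      funext t
      rw [poissonCdf, Finset.sum_range_succ, mul_add]; rfl
    rw [this]
    refine (ih.add (hasDerivAt_exp_neg_mul_pow_div_factorial n t)).congr_deriv ?_
    ring

/-- With $w_k=e^{-t}t^k/k!$, the derivative of the cdf is $-w_{n-1}$ and that of $w_n$ is
$w_{n-1}-w_n$. All terms but the cdf cancel because $tw_{n-1}=nw_n$. -/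
theorem hasDerivAt_poissonCdfPrim {n : ℕ} (hn : n ≠ 0) (t : ℝ) :
    HasDerivAt (poissonCdfPrim n) (poissonCdf n t) t := by
  obtain ⟨m, rfl⟩ := Nat.exists_eq_succ_of_ne_zero hn
  have h := ((((hasDerivAt_id t).sub_const ((m + 1 : ℕ) : ℝ)).mul (hasDerivAt_poissonCdf m t)).const_add
    ((m + 1 : ℕ) : ℝ)).sub ((hasDerivAt_exp_neg_mul_pow_div_factorial m t).const_mul ((m + 1 : ℕ) : ℝ))
  refine h.congr_deriv ?_
  simp only [id]
  rw [Nat.factorial_succ]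
  push_cast
  have : (m ! : ℝ) ≠ 0 := by positivity
  have : (m + 1 : ℝ) ≠ 0 := by positivity
  field_simp
  ring

theorem poissonCdfPrim_zero {n : ℕ} (hn : n ≠ 0) : poissonCdfPrim n 0 = 0 := by
  obtain ⟨m, rfl⟩ := Nat.exists_eq_succ_of_ne_zero hn
  have : poissonCdf (m + 1) 0 = 1 := by
    simp [poissonCdf, Finset.sum_range_succ']
  simp [poissonCdfPrim, this]

theorem tendsto_exp_neg_mul_pow_div (k : ℕ) (a : ℝ) :
    Tendsto (fun t : ℝ => Real.exp (-t) * (t ^ k / a)) atTop (𝓝 0) := by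
  have := (Real.tendsto_pow_mul_exp_neg_atTop_nhds_zero k).div_const a
  rw [zero_div] at this
  exact this.congr fun t => by ring

theorem tendsto_poissonCdfPrim (n : ℕ) : Tendsto (poissonCdfPrim n) atTop (𝓝 n) := by
  have h1 : Tendsto (poissonCdf n) atTop (𝓝 0) := by
    have : poissonCdf n = fun t => ∑ k ∈ Finset.range n, Real.exp (-t) * (t ^ k / (k ! : ℝ)) := by
      funext t; rw [poissonCdf, Finset.mul_sum]
    rw [this, ← Finset.sum_const_zero (s := Finset.range n)]
    exact tendsto_finsetSum _ fun k _ => tendsto_exp_neg_mul_pow_div k _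
  have h2 : Tendsto (fun t => t * poissonCdf n t) atTop (𝓝 0) := by
    have : (fun t => t * poissonCdf n t)
        = fun t => ∑ k ∈ Finset.range n, Real.exp (-t) * (t ^ (k + 1) / (k ! : ℝ)) := by
      funext t; rw [poissonCdf, Finset.mul_sum, Finset.mul_sum]
      exact Finset.sum_congr rfl fun k _ => by ring
    rw [this, ← Finset.sum_const_zero (s := Finset.range n)]
    exact tendsto_finsetSum _ fun k _ => tendsto_exp_neg_mul_pow_div _ _
  have h3 := ((tendsto_const_nhds (x := (n : ℝ))).add (h2.sub (h1.const_mul (n : ℝ)))).sub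
    ((tendsto_exp_neg_mul_pow_div n (n ! : ℝ)).const_mul (n : ℝ))
  simp only [mul_zero, sub_zero, add_zero] at h3
  refine h3.congr fun t => ?_
  rw [poissonCdfPrim]; ring

/-- The density of the mean empirical spectral distribution of the scaled Ginibre matrix. -/
noncomputable def circularDensity (n : ℕ) (z : ℂ) : ℝ :=
  Real.pi⁻¹ * poissonCdf n (n * ‖z‖ ^ 2)

theorem circularDensity_nonneg (n : ℕ) (z : ℂ) : 0 ≤ circularDensity n z :=
  mul_nonneg (inv_nonneg.2 Real.pi_pos.le) (poissonCdf_nonneg n (by positivity))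

theorem circularDensity_le (n : ℕ) (z : ℂ) : circularDensity n z ≤ 1 / Real.pi := by
  rw [one_div]
  exact mul_le_of_le_one_right (inv_nonneg.2 Real.pi_pos.le) (poissonCdf_le_one n (by positivity))

theorem continuous_poissonCdf (n : ℕ) : Continuous (poissonCdf n) := by
  unfold poissonCdf; fun_prop

/-- The right side is the density of the modulus in polar coordinates: the length $2\pi y$ of the
circle times $\pi^{-1}$ times the profile. -/
theorem hasDerivAt_radial {n : ℕ} (hn : n ≠ 0) (y : ℝ) :
    HasDerivAt (fun y => poissonCdfPrim n (n * y ^ 2) / n) (2 * (y * poissonCdf n (n * y ^ 2))) y := by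
  have h1 : HasDerivAt (fun y : ℝ => (n : ℝ) * y ^ 2) (n * (2 * y)) y := by
    simpa using (hasDerivAt_pow 2 y).const_mul (n : ℝ)
  refine (((hasDerivAt_poissonCdfPrim hn (n * y ^ 2)).comp y h1).div_const (n : ℝ)).congr_deriv ?_
  have : (n : ℝ) ≠ 0 := by exact_mod_cast hn
  field_simp

theorem tendsto_radial {n : ℕ} (hn : n ≠ 0) :
    Tendsto (fun y : ℝ => poissonCdfPrim n (n * y ^ 2) / n) atTop (𝓝 1) := by
  have h0 : (n : ℝ) ≠ 0 := by exact_mod_cast hn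
  have h1 : Tendsto (fun y : ℝ => (n : ℝ) * y ^ 2) atTop atTop :=
    (tendsto_pow_atTop two_ne_zero).const_mul_atTop (by positivity)
  have := ((tendsto_poissonCdfPrim n).comp h1).div_const (n : ℝ)
  rwa [div_self h0] at this

theorem volume_real_ball_zero_one : (volume : Measure ℂ).real (Metric.ball 0 1) = Real.pi := by
  simp [measureReal_def, Complex.volume_ball]

theorem integrable_circularDensity {n : ℕ} (hn : n ≠ 0) : Integrable (circularDensity n) := by
  have h := integrable_fun_norm_addHaar (volume : Measure ℂ)
    (f := fun y => Real.pi⁻¹ * poissonCdf n (n * y ^ 2))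
  refine h.2 ?_
  have h1 : IntegrableOn (fun y : ℝ => 2 * (y * poissonCdf n (n * y ^ 2))) (Set.Ioi 0) :=
    integrableOn_Ioi_deriv_of_nonneg' (fun y _ => hasDerivAt_radial hn y)
      (fun y (hy : 0 < y) => by have := poissonCdf_nonneg n (t := n * y ^ 2) (by positivity); positivity)
      (tendsto_radial hn)
  refine (h1.const_mul (Real.pi⁻¹ / 2)).congr (Eventually.of_forall fun y => ?_)
  simp only [Complex.finrank_real_complex, smul_eq_mul]
  ring

theorem integral_circularDensity {n : ℕ} (hn : n ≠ 0) : ∫ z, circularDensity n z = 1 := by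
  have h := integral_fun_norm_addHaar (volume : Measure ℂ)
    (fun y => Real.pi⁻¹ * poissonCdf n (n * y ^ 2))
  refine h.trans ?_
  have h1 := integral_Ioi_of_hasDerivAt_of_nonneg' (fun y _ => hasDerivAt_radial hn y)
      (fun y (hy : 0 < y) => by have := poissonCdf_nonneg n (t := n * y ^ 2) (by positivity); positivity)
      (tendsto_radial hn)
  rw [zero_pow two_ne_zero, mul_zero, poissonCdfPrim_zero hn, zero_div, sub_zero] at h1
  rw [volume_real_ball_zero_one, ← h1, nsmul_eq_mul, smul_eq_mul, ← integral_const_mul,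
    ← integral_const_mul]
  refine integral_congr_ae (Eventually.of_forall fun y => ?_)
  simp only [Complex.finrank_real_complex, smul_eq_mul]
  have := Real.pi_pos
  field_simp
  simp only [Nat.add_one_sub_one, pow_one, Nat.cast_ofNat]
  ring

theorem setIntegral_ball_circularDensity {n : ℕ} (hn : n ≠ 0) {R : ℝ} (hR : 0 ≤ R) :
    ∫ z in Metric.ball (0 : ℂ) R, circularDensity n z = poissonCdfPrim n (n * R ^ 2) / n := by
  have h := integral_fun_norm_addHaar (volume : Measure ℂ)
    ((Set.Iio R).indicator fun y => Real.pi⁻¹ * poissonCdf n (n * y ^ 2))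
  have hl : ∀ z : ℂ, (Set.Iio R).indicator (fun y => Real.pi⁻¹ * poissonCdf n (n * y ^ 2)) ‖z‖
      = (Metric.ball (0 : ℂ) R).indicator (circularDensity n) z := by
    intro z
    by_cases hz : ‖z‖ < R
    · rw [Set.indicator_of_mem (show ‖z‖ ∈ Set.Iio R from hz),
        Set.indicator_of_mem (mem_ball_zero_iff.2 hz)]
      rfl
    · rw [Set.indicator_of_notMem (show ‖z‖ ∉ Set.Iio R from hz),
        Set.indicator_of_notMem fun h => hz (mem_ball_zero_iff.1 h)]
  simp_rw [hl] at h
  rw [integral_indicator measurableSet_ball] at h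
  refine h.trans ?_
  have h1 := intervalIntegral.integral_eq_sub_of_hasDerivAt (a := 0) (b := R)
    (fun y _ => hasDerivAt_radial hn y) (Continuous.intervalIntegrable (by
      have := continuous_poissonCdf n
      fun_prop) _ _)
  rw [zero_pow two_ne_zero, mul_zero, poissonCdfPrim_zero hn, zero_div, sub_zero,
    intervalIntegral.integral_of_le hR, integral_Ioc_eq_integral_Ioo] at h1
  rw [← h1, volume_real_ball_zero_one, nsmul_eq_mul, smul_eq_mul, ← integral_const_mul,
    ← integral_const_mul, ← Set.Ioi_inter_Iio, ← setIntegral_indicator measurableSet_Iio]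
  refine setIntegral_congr_fun measurableSet_Ioi fun y hy => ?_
  by_cases hyR : y ∈ Set.Iio R
  · simp only [Set.indicator_of_mem hyR, Complex.finrank_real_complex, smul_eq_mul]
    have := Real.pi_pos
    field_simp
    simp only [Nat.add_one_sub_one, pow_one, Nat.cast_ofNat]
    ring
  · simp [Set.indicator_of_notMem hyR]

end Radial

/-! ### Identification of the mean spectral distribution. -/

section MeanDensity

open Matrix

theorem IsGinibre.map_entries {Ω : Type*} [MeasurableSpace Ω] {n : ℕ}
    {X : Ω → Matrix (Fin n) (Fin n) ℂ} {P : Measure Ω} [IsProbabilityMeasure P]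
    (hX : IsGinibre X P) {κ : Type*} [Fintype κ] (e : κ ≃ Fin n) :
    P.map (fun ω (q : κ × κ) => X ω (e q.1) (e q.2))
      = Measure.pi fun _ : κ × κ => stdComplexGaussian := by
  have hind : iIndepFun (fun (q : κ × κ) ω => X ω (e q.1) (e q.2)) P :=
    hX.indep.precomp (g := Prod.map e e) (e.injective.prodMap e.injective)
  rw [(iIndepFun_iff_map_fun_eq_pi_map fun q => (hX.hasLaw_entry _ _).aemeasurable).1 hind]
  congr 1
  funext q
  exact (hX.hasLaw_entry _ _).map_eq

theorem IsGinibre.aemeasurable_entries {Ω : Type*} [MeasurableSpace Ω] {n : ℕ}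
    {X : Ω → Matrix (Fin n) (Fin n) ℂ} {P : Measure Ω}
    (hX : IsGinibre X P) {κ : Type*} [Countable κ] (e : κ ≃ Fin n) :
    AEMeasurable (fun ω (q : κ × κ) => X ω (e q.1) (e q.2)) P :=
  aemeasurable_pi_lambda _ fun _ => (hX.hasLaw_entry _ _).aemeasurable

theorem measurable_empiricalSpectralDistribution {n : ℕ} {κ : Type*} [Countable κ] (f : Fin n → κ) :
    Measurable fun Y : κ × κ → ℂ =>
      empiricalSpectralDistribution (of fun i j => Y (f i, f j)) := by
  have hc : Continuous fun Y : κ × κ → ℂ =>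
      ((Real.sqrt n : ℝ) : ℂ)⁻¹ • (of fun i j => Y (f i, f j) : Matrix (Fin n) (Fin n) ℂ) := by
    refine continuous_pi fun i => continuous_pi fun j => ?_
    simp only [Matrix.smul_apply, of_apply]
    fun_prop
  exact measurable_spectralMeasure hc

theorem IsGinibre.meanSpectralDistribution_apply {Ω : Type*} [MeasurableSpace Ω] {n : ℕ}
    {X : Ω → Matrix (Fin n) (Fin n) ℂ} {P : Measure Ω} [IsProbabilityMeasure P]
    (hX : IsGinibre X P) {κ : Type*} [Fintype κ] (e : κ ≃ Fin n) {B : Set ℂ} (hB : MeasurableSet B) :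
    meanSpectralDistribution X P B = ∫⁻ Y : κ × κ → ℂ,
      empiricalSpectralDistribution (of fun i j => Y (e.symm i, e.symm j)) B
        ∂(Measure.pi fun _ => stdComplexGaussian) := by
  have hΨ := measurable_empiricalSpectralDistribution (e.symm : Fin n → κ)
  have hY := hX.aemeasurable_entries e
  have hXY : ∀ ω, X ω = of fun i j => X ω (e (e.symm i)) (e (e.symm j)) := fun ω => by
    ext i j; simp
  have hcomp : (fun ω => empiricalSpectralDistribution (X ω))
      = (fun Y : κ × κ → ℂ =>
        empiricalSpectralDistribution (of fun i j => Y (e.symm i, e.symm j))) ∘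
        fun ω (q : κ × κ) => X ω (e q.1) (e q.2) := by
    funext ω
    conv_lhs => rw [hXY ω]
    rfl
  rw [meanSpectralDistribution, hcomp, Measure.bind_apply hB (hΨ.comp_aemeasurable hY),
    ← hX.map_entries e, lintegral_map' _ hY]
  · rfl
  · exact ((Measure.measurable_coe hB).comp hΨ).aemeasurable

theorem of_blockEntries_eq_reindex {ι : Type*} {n : ℕ} (e : ι ⊕ Unit ≃ Fin n)
    (W : ι → ι ⊕ Unit → ℂ) (r : ι → ℂ) (x : ℂ) :
    (of fun i j => blockEntries (W, r, x) (e.symm i, e.symm j))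
      = reindex e e (fromBlocks (of W).toCols₁ (replicateCol Unit fun i => W i (Sum.inr ()))
        (replicateRow Unit r) (of fun _ _ => x)) := by
  ext i j
  rw [of_apply, reindex_apply, submatrix_apply]
  rcases e.symm i with a | a <;> rcases e.symm j with b | b <;> rfl

theorem ginibreDensity_sqrt_mul (m : ℕ) (z : ℂ) :
    ginibreDensity m ((Real.sqrt (m + 1 : ℕ) : ℝ) * z) = circularDensity (m + 1) z := by
  have h : Complex.normSq ((Real.sqrt (m + 1 : ℕ) : ℝ) * z) = (m + 1 : ℕ) * ‖z‖ ^ 2 := by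
    rw [Complex.normSq_mul, Complex.normSq_ofReal, Real.mul_self_sqrt (by positivity),
      Complex.normSq_eq_norm_sq]
  rw [ginibreDensity, circularDensity, poissonCdf, h, mul_assoc]

theorem setLIntegral_ginibreDensity (m : ℕ) {B : Set ℂ} (hB : MeasurableSet B) :
    ∫⁻ z in (fun z : ℂ => ((Real.sqrt (m + 1 : ℕ) : ℝ) : ℂ)⁻¹ * z) ⁻¹' B,
        ENNReal.ofReal (ginibreDensity m z)
      = (m + 1 : ℕ) * ∫⁻ z in B, ENNReal.ofReal (circularDensity (m + 1) z) := by
  set a : ℂ := ((Real.sqrt (m + 1 : ℕ) : ℝ) : ℂ) with ha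
  have ha2 : Complex.normSq a = (m + 1 : ℕ) := by
    rw [ha, Complex.normSq_ofReal, Real.mul_self_sqrt (by positivity)]
  have ha0 : a ≠ 0 := by
    rw [← Complex.normSq_pos, ha2]; positivity
  have hB' : MeasurableSet ((fun z : ℂ => a⁻¹ * z) ⁻¹' B) := (measurable_const_mul a⁻¹) hB
  have hgm : Measurable fun z => ENNReal.ofReal (ginibreDensity m z) := by
    have := Complex.continuous_normSq.measurable
    unfold ginibreDensity
    fun_prop
  have hdet : (a • (LinearMap.id : ℂ →ₗ[ℂ] ℂ)).det = a := by
    rw [LinearMap.det_smul]; simp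
  rw [← lintegral_indicator hB', lintegral_eq_normSq_det_mul_lintegral_comp volume
    (a • (LinearMap.id : ℂ →ₗ[ℂ] ℂ)) (by rw [hdet]; exact ha0) (hgm.indicator hB'), hdet, ha2,
    ← lintegral_indicator hB, ENNReal.ofReal_natCast]
  congr 1
  refine lintegral_congr fun z => ?_
  rw [LinearMap.smul_apply, LinearMap.id_apply, smul_eq_mul]
  have hiff : a * z ∈ (fun z : ℂ => a⁻¹ * z) ⁻¹' B ↔ z ∈ B := by
    rw [Set.mem_preimage, inv_mul_cancel_left₀ ha0]
  by_cases hz : z ∈ B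
  · rw [Set.indicator_of_mem (hiff.2 hz), Set.indicator_of_mem hz, ginibreDensity_sqrt_mul]
  · rw [Set.indicator_of_notMem (fun h => hz (hiff.1 h)), Set.indicator_of_notMem hz]

theorem lintegral_circularDensity {n : ℕ} (hn : n ≠ 0) :
    ∫⁻ z, ENNReal.ofReal (circularDensity n z) = 1 := by
  rw [← ofReal_integral_eq_lintegral_ofReal (integrable_circularDensity hn)
    (Eventually.of_forall (circularDensity_nonneg n)), integral_circularDensity hn,
    ENNReal.ofReal_one]

/-- Eigenvalue counting gives only domination of the explicit measure. Equality follows by comparing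
total masses. -/
theorem IsGinibre.meanSpectralDistribution_eq_withDensity {Ω : Type*} [MeasurableSpace Ω] {n : ℕ}
    (hn : n ≠ 0) {X : Ω → Matrix (Fin n) (Fin n) ℂ} {P : Measure Ω} [IsProbabilityMeasure P]
    (hX : IsGinibre X P) :
    meanSpectralDistribution X P
      = volume.withDensity fun z => ENNReal.ofReal (circularDensity n z) := by
  obtain ⟨m, rfl⟩ := Nat.exists_eq_succ_of_ne_zero hn
  let e : Fin m ⊕ Unit ≃ Fin (m + 1) := Fintype.equivFinOfCardEq (by simp)
  have hne0 : ((m + 1 : ℕ) : ℝ≥0∞) ≠ 0 := by exact_mod_cast hn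
  have hnet : ((m + 1 : ℕ) : ℝ≥0∞) ≠ ∞ := ENNReal.natCast_ne_top _
  let Ψ : Set ℂ → ((Fin m ⊕ Unit) × (Fin m ⊕ Unit) → ℂ) → ℝ≥0∞ := fun B Y =>
    empiricalSpectralDistribution (of fun i j => Y (e.symm i, e.symm j)) B
  have hΨ : ∀ B, MeasurableSet B → Measurable (Ψ B) := fun B hB =>
    (Measure.measurable_coe hB).comp
      (measurable_empiricalSpectralDistribution (e.symm : Fin (m + 1) → Fin m ⊕ Unit))
  have hle : (volume.withDensity fun z => ENNReal.ofReal (circularDensity (m + 1) z))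
      ≤ meanSpectralDistribution X P := by
    refine Measure.le_iff.2 fun B hB => ?_
    have hblock : Measurable (blockEntries (ι := Fin m)) := measurable_blockEntries
    have hΨb : Measurable fun p => Ψ B (blockEntries (ι := Fin m) p) := (hΨ B hB).comp hblock
    have key := lintegral_ginibreDensity_le (ι := Fin m)
      (B := (fun z : ℂ => ((Real.sqrt (m + 1 : ℕ) : ℝ) : ℂ)⁻¹ * z) ⁻¹' B)
      (measurable_const_mul _ hB)
      -- The factor $m+1$ turns the normalised spectral measure into a number of eigenvalues.
      -- Rescaling the density by $\sqrt{m+1}$ produces the same factor, which is then cancelled.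
      (N := fun W r x => (m + 1 : ℕ) * Ψ B (blockEntries (W, r, x))) (by
        intro W r x F hF
        refine card_le_empiricalSpectralDistribution hn _ hB F fun z hz => ⟨(hF z hz).1, ?_⟩
        have h2 := (hF z hz).2
        rw [of_blockEntries_eq_reindex, ← h2, ← det_reindex_self e]
        congr 1
        ext i j
        simp [one_apply])
    rw [Fintype.card_fin, setLIntegral_ginibreDensity m hB] at key
    simp_rw [lintegral_const_mul' _ _ hnet] at key
    rw [ENNReal.mul_le_mul_iff_right hne0 hnet] at key
    rw [withDensity_apply _ hB, hX.meanSpectralDistribution_apply e hB]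
    refine key.trans (le_of_eq ?_)
    rw [← map_blockEntries, lintegral_map (hΨ B hB) hblock, lintegral_prod _ hΨb.aemeasurable]
    refine lintegral_congr fun W => ?_
    have hW : Measurable fun y => Ψ B (blockEntries (W, y)) := hΨb.comp measurable_prodMk_left
    rw [lintegral_prod _ hW.aemeasurable]
  have huniv : (volume.withDensity fun z => ENNReal.ofReal (circularDensity (m + 1) z)) Set.univ = 1 := by
    rw [withDensity_apply _ MeasurableSet.univ, Measure.restrict_univ, lintegral_circularDensity hn]
  have hmean : meanSpectralDistribution X P Set.univ ≤ 1 := by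
    rw [hX.meanSpectralDistribution_apply e MeasurableSet.univ]
    refine (lintegral_mono fun Y => spectralMeasure_univ_le _).trans ?_
    simp
  have : IsFiniteMeasure (volume.withDensity fun z => ENNReal.ofReal (circularDensity (m + 1) z)) :=
    ⟨huniv.trans_lt ENNReal.one_lt_top⟩
  refine (Measure.eq_of_le_of_measure_univ_eq hle (le_antisymm ?_ ?_)).symm
  · exact hle _
  · rw [huniv]; exact hmean

end MeanDensity

/-! ### Comparison of two probability measures, one carried by a set on which it dominates the
other. -/

section Discrepancy

variable {α : Type*} [MeasurableSpace α] {μ ν : Measure α} [IsProbabilityMeasure μ]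
  [IsProbabilityMeasure ν] {D : Set α}

/-- Inside `D` the difference $\nu-\mu$ is nonnegative on every measurable set, hence monotone. -/
theorem abs_measureReal_sub_le_of_subset
    (hle : ∀ B, MeasurableSet B → B ⊆ D → μ.real B ≤ ν.real B) {B E : Set α}
    (hB : MeasurableSet B) (hE : MeasurableSet E) (hBE : B ⊆ E) (hED : E ⊆ D) :
    |μ.real B - ν.real B| ≤ ν.real E - μ.real E := by
  have h1 := hle B hB (hBE.trans hED)
  have h2 := hle (E \ B) (hE.diff hB) (Set.sdiff_subset.trans hED)
  rw [measureReal_sdiff hBE hB, measureReal_sdiff hBE hB] at h2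
  rw [abs_of_nonpos (by linarith)]
  linarith

theorem abs_measureReal_sub_le_of_disjoint (hν : ν.real Dᶜ = 0) {B E : Set α}
    (hE : MeasurableSet E) (hBE : B ⊆ Eᶜ) (hDE : D ⊆ E) :
    |μ.real B - ν.real B| ≤ 1 - μ.real E := by
  have h1 : ν.real B ≤ ν.real Dᶜ := measureReal_mono (hBE.trans (Set.compl_subset_compl.2 hDE))
  have h2 : μ.real B ≤ μ.real Eᶜ := measureReal_mono hBE
  rw [probReal_compl_eq_one_sub hE] at h2
  have h3 : ν.real B = 0 := le_antisymm (h1.trans hν.le) measureReal_nonneg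
  rwa [h3, sub_zero, abs_of_nonneg measureReal_nonneg]

/-- The parts of `B` inside and outside `D` contribute with opposite signs, and each is at most
$1-\mu(D)$ in absolute value. The two contributions therefore do not add up. -/
theorem abs_measureReal_sub_le (hD : MeasurableSet D) (hν : ν.real Dᶜ = 0)
    (hle : ∀ B, MeasurableSet B → B ⊆ D → μ.real B ≤ ν.real B) {B : Set α}
    (hB : MeasurableSet B) : |μ.real B - ν.real B| ≤ 1 - μ.real D := by
  have hνD : ν.real D = 1 := by
    have := probReal_compl_eq_one_sub (μ := ν) hD
    linarith
  have h1 := hle (B ∩ D) (hB.inter hD) Set.inter_subset_right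
  have h2 := abs_measureReal_sub_le_of_subset hle (hB.inter hD) hD Set.inter_subset_right subset_rfl
  have h3 := abs_measureReal_sub_le_of_disjoint (μ := μ) hν hD
    (show B \ D ⊆ Dᶜ from fun x hx => hx.2) subset_rfl
  have h4 := measureReal_inter_add_sdiff (μ := μ) (s := B) hD
  have h5 := measureReal_inter_add_sdiff (μ := ν) (s := B) hD
  have h6 : ν.real (B \ D) = 0 :=
    le_antisymm ((measureReal_mono fun x hx => hx.2).trans hν.le) measureReal_nonneg
  have h7 : 0 ≤ μ.real (B \ D) := measureReal_nonneg
  rw [hνD, abs_le] at h2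
  rw [h6, sub_zero, abs_le] at h3
  rw [abs_le]
  constructor <;> linarith [h2.1, h2.2, h3.1, h3.2]

end Discrepancy

/-! ### The circular law and its domination inside the disc. -/

section CircularLaw

theorem circularLaw_apply {B : Set ℂ} (hB : MeasurableSet B) :
    circularLaw B = ENNReal.ofReal (1 / Real.pi) * volume (Metric.ball 0 1 ∩ B) := by
  rw [circularLaw, withDensity_apply _ hB, setLIntegral_indicator measurableSet_ball,
    lintegral_const, Measure.restrict_apply MeasurableSet.univ, Set.univ_inter]

theorem circularLaw_real_of_subset {B : Set ℂ} (hB : MeasurableSet B) (hBD : B ⊆ Metric.ball 0 1) :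
    circularLaw.real B = 1 / Real.pi * volume.real B := by
  rw [measureReal_def, circularLaw_apply hB, Set.inter_eq_right.2 hBD, ENNReal.toReal_mul,
    ENNReal.toReal_ofReal (by positivity)]
  rfl

theorem volume_real_ball_zero {R : ℝ} (hR : 0 ≤ R) :
    (volume : Measure ℂ).real (Metric.ball 0 R) = Real.pi * R ^ 2 := by
  rw [measureReal_def, Complex.volume_ball, ENNReal.toReal_mul, ENNReal.toReal_pow,
    ENNReal.toReal_ofReal hR, mul_comm]
  rfl

theorem circularLaw_real_ball {R : ℝ} (hR : 0 ≤ R) (hR1 : R ≤ 1) :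
    circularLaw.real (Metric.ball 0 R) = R ^ 2 := by
  rw [circularLaw_real_of_subset measurableSet_ball (Metric.ball_subset_ball hR1),
    volume_real_ball_zero hR]
  field_simp

instance : IsProbabilityMeasure circularLaw where
  measure_univ := by
    rw [circularLaw_apply MeasurableSet.univ, Set.inter_univ, Complex.volume_ball,
      ENNReal.ofReal_one, one_pow, one_mul, ← ENNReal.ofReal_coe_nnreal,
      ← ENNReal.ofReal_mul (by positivity), NNReal.coe_real_pi, one_div,
      inv_mul_cancel₀ Real.pi_ne_zero, ENNReal.ofReal_one]

theorem circularLaw_real_compl_ball : circularLaw.real (Metric.ball 0 1)ᶜ = 0 := by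
  rw [probReal_compl_eq_one_sub measurableSet_ball, circularLaw_real_ball zero_le_one le_rfl]
  simp

theorem withDensity_circularDensity_real {n : ℕ} (hn : n ≠ 0) {B : Set ℂ} (hB : MeasurableSet B) :
    (volume.withDensity fun z => ENNReal.ofReal (circularDensity n z)).real B
      = ∫ z in B, circularDensity n z := by
  rw [measureReal_def, withDensity_apply _ hB, ← ofReal_integral_eq_lintegral_ofReal
    (integrable_circularDensity hn).integrableOn (Eventually.of_forall (circularDensity_nonneg n)),
    ENNReal.toReal_ofReal (integral_nonneg (circularDensity_nonneg n))]

theorem isProbabilityMeasure_withDensity_circularDensity {n : ℕ} (hn : n ≠ 0) :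
    IsProbabilityMeasure (volume.withDensity fun z => ENNReal.ofReal (circularDensity n z)) :=
  ⟨by rw [withDensity_apply _ MeasurableSet.univ, Measure.restrict_univ,
    lintegral_circularDensity hn]⟩

theorem withDensity_circularDensity_real_le {n : ℕ} (hn : n ≠ 0) {B : Set ℂ} (hB : MeasurableSet B)
    (hBD : B ⊆ Metric.ball 0 1) :
    (volume.withDensity fun z => ENNReal.ofReal (circularDensity n z)).real B
      ≤ circularLaw.real B := by
  have hfin : volume B ≠ ∞ := ((measure_mono hBD).trans_lt measure_ball_lt_top).ne
  rw [withDensity_circularDensity_real hn hB, circularLaw_real_of_subset hB hBD]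
  calc ∫ z in B, circularDensity n z ≤ ∫ _ in B, 1 / Real.pi :=
        setIntegral_mono (integrable_circularDensity hn).integrableOn
          (integrableOn_const hfin) (circularDensity_le n)
    _ = 1 / Real.pi * volume.real B := by
        rw [setIntegral_const, smul_eq_mul, mul_comm]

end CircularLaw

/-! ### Stirling's formula and Chernoff bounds. -/

section Asymptotics

open scoped Nat Topology

theorem poissonCdfPrim_self_div {n : ℕ} (hn : n ≠ 0) :
    1 - poissonCdfPrim n n / n = Real.exp (-n) * (n ^ n / (n ! : ℝ)) := by
  have : (n : ℝ) ≠ 0 := by exact_mod_cast hn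
  rw [poissonCdfPrim]
  field_simp
  ring

/-- A Chernoff bound for the Poisson weights away from the mean. -/
theorem exp_neg_mul_pow_div_factorial_le (n : ℕ) {R : ℝ} (hR : 0 ≤ R) :
    Real.exp (-(n * R ^ 2)) * ((n * R ^ 2) ^ n / (n ! : ℝ)) ≤ Real.exp (-(n * (R - 1) ^ 2)) := by
  have h1 : (n : ℝ) ^ n / (n ! : ℝ) ≤ Real.exp n := Real.pow_div_factorial_le_exp _ (by positivity) n
  -- This choice completes the square: $-R^2+1+2(R-1)=-(R-1)^2$.
  have h2 : R ≤ Real.exp (R - 1) := by linarith [Real.add_one_le_exp (R - 1)]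
  have h3 : (R ^ 2) ^ n ≤ Real.exp (2 * n * (R - 1)) := by
    calc (R ^ 2) ^ n = R ^ (2 * n) := by rw [pow_mul]
      _ ≤ Real.exp (R - 1) ^ (2 * n) := by gcongr
      _ = Real.exp (2 * n * (R - 1)) := by
        rw [← Real.exp_nat_mul]; push_cast; ring_nf
  calc Real.exp (-(n * R ^ 2)) * ((n * R ^ 2) ^ n / (n ! : ℝ))
      = Real.exp (-(n * R ^ 2)) * ((n : ℝ) ^ n / (n ! : ℝ) * (R ^ 2) ^ n) := by rw [mul_pow]; ring
    _ ≤ Real.exp (-(n * R ^ 2)) * (Real.exp n * Real.exp (2 * n * (R - 1))) := by gcongr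
    _ = Real.exp (-(n * (R - 1) ^ 2)) := by
        rw [← Real.exp_add, ← Real.exp_add]; ring_nf

theorem sq_sub_poissonCdfPrim_div_le {n : ℕ} (hn : n ≠ 0) {R : ℝ} (hR : 0 ≤ R) (hR1 : R ≤ 1) :
    R ^ 2 - poissonCdfPrim n (n * R ^ 2) / n ≤ Real.exp (-(n * (R - 1) ^ 2)) := by
  refine le_trans ?_ (exp_neg_mul_pow_div_factorial_le n hR)
  have hn0 : (n : ℝ) ≠ 0 := by exact_mod_cast hn
  have h1 := poissonCdf_le_one n (t := n * R ^ 2) (by positivity)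
  have h2 : 0 ≤ (1 - R ^ 2) * (1 - poissonCdf n (n * R ^ 2)) :=
    mul_nonneg (by nlinarith) (by linarith)
  -- The deficit of mass in the ball is the Poisson weight at `n` minus a nonnegative term. That
  -- term is dropped, here and in the mirror case $R\ge1$.
  have h3 : R ^ 2 - poissonCdfPrim n (n * R ^ 2) / n
      = Real.exp (-(n * R ^ 2)) * ((n * R ^ 2) ^ n / (n ! : ℝ))
        - (1 - R ^ 2) * (1 - poissonCdf n (n * R ^ 2)) := by
    rw [poissonCdfPrim]
    field_simp
    ring
  linarith

theorem one_sub_poissonCdfPrim_div_le {n : ℕ} (hn : n ≠ 0) {R : ℝ} (hR1 : 1 ≤ R) :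
    1 - poissonCdfPrim n (n * R ^ 2) / n ≤ Real.exp (-(n * (R - 1) ^ 2)) := by
  refine le_trans ?_ (exp_neg_mul_pow_div_factorial_le n (by linarith))
  have hn0 : (n : ℝ) ≠ 0 := by exact_mod_cast hn
  have h1 := poissonCdf_nonneg n (t := n * R ^ 2) (by positivity)
  have h2 : 0 ≤ (R ^ 2 - 1) * poissonCdf n (n * R ^ 2) :=
    mul_nonneg (by nlinarith) h1
  have h3 : 1 - poissonCdfPrim n (n * R ^ 2) / n
      = Real.exp (-(n * R ^ 2)) * ((n * R ^ 2) ^ n / (n ! : ℝ))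
        - (R ^ 2 - 1) * poissonCdf n (n * R ^ 2) := by
    rw [poissonCdfPrim]
    field_simp
    ring
  linarith

theorem isEquivalent_exp_neg_mul_pow_div_factorial :
    (fun n : ℕ => Real.exp (-n) * ((n : ℝ) ^ n / (n ! : ℝ)))
      ~[atTop] fun n : ℕ => 1 / Real.sqrt (2 * Real.pi * n) := by
  have h := (IsEquivalent.refl (u := fun n : ℕ => Real.exp (-n) * (n : ℝ) ^ n) (l := atTop)).div
    Stirling.factorial_isEquivalent_stirling
  refine (h.congr_left (Eventually.of_forall fun n => ?_)).congr_right ?_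
  · simp only [Pi.div_apply]; ring
  · filter_upwards [eventually_ne_atTop 0] with n hn
    have hn0 : (n : ℝ) ≠ 0 := by exact_mod_cast hn
    simp only [Pi.div_apply]
    rw [div_pow, ← Real.exp_nat_mul, mul_one, Real.exp_neg, mul_right_comm 2 Real.pi]
    have := Real.exp_pos (n : ℝ)
    have : Real.sqrt (2 * n * Real.pi) ≠ 0 := (Real.sqrt_pos.2 (by positivity)).ne'
    field_simp

end Asymptotics

/-! ### The three assertions. -/

section Main

variable {Ω : Type*} [MeasurableSpace Ω] {n : ℕ} {X : Ω → Matrix (Fin n) (Fin n) ℂ} {P : Measure Ω}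
  [IsProbabilityMeasure P]

theorem IsGinibre.meanSpectralDistribution_real_ball (hn : n ≠ 0) (hX : IsGinibre X P) {R : ℝ}
    (hR : 0 ≤ R) :
    (meanSpectralDistribution X P).real (Metric.ball 0 R) = poissonCdfPrim n (n * R ^ 2) / n := by
  rw [hX.meanSpectralDistribution_eq_withDensity hn,
    withDensity_circularDensity_real hn measurableSet_ball, setIntegral_ball_circularDensity hn hR]

theorem IsGinibre.isProbabilityMeasure_meanSpectralDistribution (hn : n ≠ 0)
    (hX : IsGinibre X P) : IsProbabilityMeasure (meanSpectralDistribution X P) := by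
  rw [hX.meanSpectralDistribution_eq_withDensity hn]
  exact isProbabilityMeasure_withDensity_circularDensity hn

theorem IsGinibre.meanSpectralDistribution_real_le (hn : n ≠ 0) (hX : IsGinibre X P) (B : Set ℂ)
    (hB : MeasurableSet B) (hBD : B ⊆ Metric.ball 0 1) :
    (meanSpectralDistribution X P).real B ≤ circularLaw.real B := by
  rw [hX.meanSpectralDistribution_eq_withDensity hn]
  exact withDensity_circularDensity_real_le hn hB hBD

theorem IsGinibre.abs_meanSpectralDistribution_ball_one (hn : n ≠ 0) (hX : IsGinibre X P) :
    |(meanSpectralDistribution X P).real (Metric.ball 0 1) - circularLaw.real (Metric.ball 0 1)|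
      = 1 - (meanSpectralDistribution X P).real (Metric.ball 0 1) := by
  have := hX.isProbabilityMeasure_meanSpectralDistribution hn
  rw [circularLaw_real_ball zero_le_one le_rfl, one_pow, abs_sub_comm, abs_of_nonneg]
  linarith [measureReal_le_one (μ := meanSpectralDistribution X P) (s := Metric.ball 0 1)]

theorem IsGinibre.discrepancy_eq (hn : n ≠ 0) (hX : IsGinibre X P) :
    discrepancy (meanSpectralDistribution X P) circularLaw
      = |(meanSpectralDistribution X P).real (Metric.ball 0 1)
          - circularLaw.real (Metric.ball 0 1)| := by
  have := hX.isProbabilityMeasure_meanSpectralDistribution hn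
  refine IsGreatest.csSup_eq ⟨⟨Metric.ball 0 1, ⟨0, 1, one_pos, rfl⟩, rfl⟩, ?_⟩
  rintro _ ⟨_, ⟨z₀, R, _, rfl⟩, rfl⟩
  rw [hX.abs_meanSpectralDistribution_ball_one hn]
  exact abs_measureReal_sub_le measurableSet_ball circularLaw_real_compl_ball
    (hX.meanSpectralDistribution_real_le hn) measurableSet_ball

theorem IsGinibre.discrepancy_eq_exp (hn : n ≠ 0) (hX : IsGinibre X P) :
    discrepancy (meanSpectralDistribution X P) circularLaw
      = Real.exp (-n) * ((n : ℝ) ^ n / (Nat.factorial n : ℝ)) := by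
  rw [hX.discrepancy_eq hn, hX.abs_meanSpectralDistribution_ball_one hn,
    hX.meanSpectralDistribution_real_ball hn zero_le_one, one_pow, mul_one,
    poissonCdfPrim_self_div hn]

theorem IsGinibre.supDiff_ballsAwayFromEdge_le (hn : n ≠ 0) (hX : IsGinibre X P) {ε : ℝ}
    (hε : 0 < ε) :
    supDiff (ballsAwayFromEdge ε) (meanSpectralDistribution X P) circularLaw
      ≤ Real.exp (-(n * ε ^ 2)) := by
  have := hX.isProbabilityMeasure_meanSpectralDistribution hn
  refine Real.sSup_le ?_ (Real.exp_pos _).le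
  rintro _ ⟨_, ⟨⟨z₀, r, hr, rfl⟩, hB⟩, rfl⟩
  rcases hB with hB | hB
  · refine (abs_measureReal_sub_le_of_disjoint circularLaw_real_compl_ball measurableSet_ball hB
      (Metric.ball_subset_ball (by linarith))).trans ?_
    rw [hX.meanSpectralDistribution_real_ball hn (by linarith)]
    simpa using one_sub_poissonCdfPrim_div_le hn (R := 1 + ε) (by linarith)
  -- A nonempty ball inside $B_{1-\varepsilon}(0)$ forces $\varepsilon<1$, so large $\varepsilon$
  -- needs no separate treatment.
  · have hpos : 0 < 1 - ε := Metric.nonempty_ball.1 ((Metric.nonempty_ball.2 hr).mono hB)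
    refine (abs_measureReal_sub_le_of_subset (hX.meanSpectralDistribution_real_le hn)
      measurableSet_ball measurableSet_ball hB (Metric.ball_subset_ball (by linarith))).trans ?_
    rw [hX.meanSpectralDistribution_real_ball hn hpos.le,
      circularLaw_real_ball hpos.le (by linarith)]
    simpa using sq_sub_poissonCdfPrim_div_le hn hpos.le (by linarith)

end Main

theorem lemma1p1 :
    ∃ C : ℝ, 0 < C ∧
      ∀ (Ω : ℕ → Type*) [∀ n, MeasurableSpace (Ω n)]
        (P : ∀ n, Measure (Ω n)) [∀ n, IsProbabilityMeasure (P n)]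
        (X : ∀ n, Ω n → Matrix (Fin n) (Fin n) ℂ), (∀ n, IsGinibre (X n) (P n)) →
        ((fun n : ℕ => discrepancy (meanSpectralDistribution (X n) (P n)) circularLaw)
            ~[atTop] (fun n : ℕ => 1 / Real.sqrt (2 * Real.pi * n))) ∧
        (∀ n : ℕ, 1 ≤ n →
          discrepancy (meanSpectralDistribution (X n) (P n)) circularLaw =
            |(meanSpectralDistribution (X n) (P n)).real (Metric.ball 0 1)
              - circularLaw.real (Metric.ball 0 1)|) ∧
        (∀ n : ℕ, 1 ≤ n → ∀ ε : ℝ, 0 < ε →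
          supDiff (ballsAwayFromEdge ε) (meanSpectralDistribution (X n) (P n)) circularLaw
            ≤ C * Real.exp (-(n * ε ^ 2))) := by
  refine ⟨1, one_pos, fun Ω _ P _ X hX => ⟨?_, fun n hn => ?_, fun n hn ε hε => ?_⟩⟩
  · refine isEquivalent_exp_neg_mul_pow_div_factorial.congr_left ?_
    filter_upwards [eventually_ne_atTop 0] with n hn
    exact ((hX n).discrepancy_eq_exp hn).symm
  · exact (hX n).discrepancy_eq (Nat.one_le_iff_ne_zero.1 hn)
  · rw [one_mul]
    exact (hX n).supDiff_ballsAwayFromEdge_le (Nat.one_le_iff_ne_zero.1 hn) hε
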